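/- Let $(\mathsf X,\pi)$ and $(\mathsf V,\nu)$ be probability spaces, $\mu=\pi\otimes\nu$, and let $\mathrm L^2(\mu)$ be the real Hilbert space with norm $\|\cdot\|_2$ and inner product $\langle\cdot,\cdot\rangle_2$; write $\mu(f)=\int f\,\mathrm d\mu$ and $\Pi_vf(x,v)=\int_{\mathsf V}f(x,w)\,\mathrm d\nu(w)$. Let $m_2>0$ (for $\mathsf V\subset\mathbb R^d$ one takes $m_2=\int v_1^2\,\mathrm d\nu(v)$). Let $(\mathcal L,\mathrm D(\mathcal L))$ be an operator on $\mathrm L^2(\mu)$, $\mathsf C\subset\mathrm L^2(\mu)$ a linear subspace and $\Psi:\mathrm L^2(\mu)\to[0,\infty]$, such that the following hold. 1. $\mathcal L$ is closed and generates a strongly continuous contraction semigroup $(P_t)_{t\ge0}$ on $\mathrm L^2(\mu)$; $\mu$ is stationary for it, i.e. $\mu(P_tf)=\mu(f)$ for all $f\in \mathrm L^2(\mu)$, $t\ge 0$; $\mathsf C$ is a core for $\mathcal L$, dense in $\mathrm L^2(\mu)$, with $\mathsf C\subset\mathrm D(\mathcal L)\cap\mathrm D(\mathcal L^*)$. Put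 $\mathcal S=(\mathcal L+\mathcal L^*)/2$ and $\mathcal T=(\mathcal L-\mathcal L^*)/2$, both with domain $\mathsf C$. 2. $\Pi_v\mathsf C\subset\mathsf C$. Under 1 and 2, $\mathcal T\Pi_v$ (with domain $\{f:\Pi_vf\in\mathsf C\}$) is closable with closure $\overline{\mathcal T\Pi_v}$. Put $G=(\mathcal T\Pi_v)^*\,\overline{\mathcal T\Pi_v}$ with its natural domain and $\mathcal A=(m_2\mathrm{Id}+G)^{-1}(-\mathcal T\Pi_v)^*$ with $\mathrm D(\mathcal A)=\mathrm D((\mathcal T\Pi_v)^*)$; its closure $\overline{\mathcal A}$ is bounded on $\mathrm L^2(\mu)$. 3. $\mathrm{Ran}(\Pi_v)\subset\mathrm{Ker}(\mathcal S^*)$, and $\Pi_v\mathcal T\Pi_vf=0$ for all $f\in\mathsf C$. 4. There is $R_0\ge1$ such that for all $f\in\mathsf C$ $$|\langle\overline{\mathcal A}\mathcal T(\mathrm{Id}-\Pi_v)f,f\rangle_2+\langle\overline{\mathcal A}\mathcal Sf,f\rangle_2|\le R_0\|(\mathrm{Id}-\Pi_v)f\|_2\|\Pi_vf\|_2 .$$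 5. $\{\Psi<\infty\}$ is dense in $\mathrm L^2(\mu)$; every $f\in\mathrm D(\mathcal L)$ is the $\mathrm L^2(\mu)$-limit of some $(f_n)\subset\mathsf C$ with $\limsup_n\langle-\mathcal Lf_n,f_n\rangle_2\le\langle-\mathcal Lf,f\rangle_2$ and $\limsup_n\Psi(f_n)\le\Psi(f)$; and $\Psi(P_tf)\le\Psi(f)$, $\Psi(\mathrm e^{-tG}f)\le\Psi(f)$, $\Psi(\Pi_vf)\le\Psi(f)$ for all $f\in\mathrm L^2(\mu)$, $t\ge0$. 6. There are decreasing functions $\alpha_1,\alpha_2:(0,\infty)\to[1,\infty)$ such that for all $r>0$ $$\|\Pi_vf-\mu(f)\|_2^2\le\alpha_1(r)\|\overline{\mathcal T\Pi_v}f\|_2^2+r\Psi(\Pi_vf)\quad(f\in\mathrm D(\overline{\mathcal T\Pi_v})),$$ $$\|(\mathrm{Id}-\Pi_v)f\|_2^2\le\alpha_2(r)\langle-\mathcal Sf,f\rangle_2+r\Psi(f)\quad(f\in\mathsf C).$$ Then there exist constants $c_1,c_2>0$ such that $$\|P_tf-\mu(f)\|_2^2\le\xi(t)\left(\|f\|_2^2+\Psi(f)\right)\qquad\forall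 t\ge0,\ f\in\mathrm D(\mathcal L),$$ $$\xi(t)=c_1\inf\Big\{r>0:\ c_2t\ge\alpha_1(r)^2\,\alpha_2\Big(\frac r{\alpha_1(r)^2}\Big)\log\frac1r\Big\}.$$ If moreover $m_2\ge1$, one may take $$c_1=\frac{2\max\Big\{\frac{1+\epsilon(m_2/2)^{-1/2}}2,\ \big(2+(m_2/2)^{-1/2}\big)\big[R_0^2(1+m_2)^2+1\big]\Big\}}{1-\epsilon(m_2/2)^{-1/2}},\qquad c_2=\frac1{R_0^2\big(2+(m_2/2)^{-1/2}\big)(1+m_2)^2},$$ where $$\epsilon=\sup_{r>0}\frac1{\alpha_2(r/\alpha_1(r)^2)\,[R_0^2(\alpha_1(r)+m_2)+2]} .$$ -/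

import Mathlib

open MeasureTheory Filter Topology Set
open scoped NNReal ENNReal InnerProductSpace LinearPMap

noncomputable section

namespace Hypocoercivity

/-! ### Unbounded operators -/

section Operators

variable {E F G : Type*} [AddCommGroup E] [Module ℝ E] [AddCommGroup F] [Module ℝ F]
  [AddCommGroup G] [Module ℝ G]

/-- The value of an unbounded operator at `f`; it is only ever used for `f` in the domain
(outside the domain the value is `0`). -/
def val (A : E →ₗ.[ℝ] F) (f : E) : F := by
  classical exact if h : f ∈ A.domain then A ⟨f, h⟩ else 0

theorem val_of_mem (A : E →ₗ.[ℝ] F) {f : E} (h : f ∈ A.domain) : val A f = A ⟨f, h⟩ := by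
  simp [val, h]

/-- The composition `B A` of unbounded operators, with its natural domain
`{f ∈ D(A) : A f ∈ D(B)}`. -/
def pcomp (B : F →ₗ.[ℝ] G) (A : E →ₗ.[ℝ] F) : E →ₗ.[ℝ] G where
  domain :=
    { carrier := {f | f ∈ A.domain ∧ val A f ∈ B.domain}
      zero_mem' := by
        refine ⟨A.domain.zero_mem, ?_⟩
        rw [val_of_mem A A.domain.zero_mem]
        have : A ⟨0, A.domain.zero_mem⟩ = 0 := A.map_zero
        rw [this]; exact B.domain.zero_mem
      add_mem' := by
        rintro f g ⟨hf, hf'⟩ ⟨hg, hg'⟩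
        refine ⟨A.domain.add_mem hf hg, ?_⟩
        rw [val_of_mem A hf] at hf'
        rw [val_of_mem A hg] at hg'
        rw [val_of_mem A (A.domain.add_mem hf hg)]
        have : A ⟨f + g, A.domain.add_mem hf hg⟩ = A ⟨f, hf⟩ + A ⟨g, hg⟩ :=
          A.map_add ⟨f, hf⟩ ⟨g, hg⟩
        rw [this]; exact B.domain.add_mem hf' hg'
      smul_mem' := by
        rintro c f ⟨hf, hf'⟩
        refine ⟨A.domain.smul_mem c hf, ?_⟩
        rw [val_of_mem A hf] at hf'
        rw [val_of_mem A (A.domain.smul_mem c hf)]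
        have : A ⟨c • f, A.domain.smul_mem c hf⟩ = c • A ⟨f, hf⟩ := A.map_smul c ⟨f, hf⟩
        rw [this]; exact B.domain.smul_mem c hf' }
  toFun :=
    { toFun := fun f => B ⟨A ⟨f.1, f.2.1⟩, by simpa [val_of_mem A f.2.1] using f.2.2⟩
      map_add' := by
        intro f g
        rw [← B.map_add]
        congr 1
        exact Subtype.ext (A.map_add ⟨f.1, f.2.1⟩ ⟨g.1, g.2.1⟩)
      map_smul' := by
        intro c f
        rw [RingHom.id_apply, ← B.map_smul]
        congr 1
        exact Subtype.ext (A.map_smul c ⟨f.1, f.2.1⟩) }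

end Operators

section Hilbert

variable {H : Type*} [NormedAddCommGroup H] [InnerProductSpace ℝ H]

/-- `P` is a strongly continuous semigroup of linear contractions. -/
structure IsContractionSemigroup (P : ℝ≥0 → H →L[ℝ] H) : Prop where
  zero : P 0 = ContinuousLinearMap.id ℝ H
  add : ∀ s t, P (s + t) = (P s).comp (P t)
  contraction : ∀ t, ‖P t‖ ≤ 1
  strongly_continuous : ∀ f, Tendsto (fun t => P t f) (𝓝 0) (𝓝 f)

/-- The operator `L` generates the strongly continuous contraction semigroup `P`: `f ∈ D(L)` and
`L f = g` exactly when `(P t f - f) / t → g` as `t ↓ 0`. -/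
structure Generates (L : H →ₗ.[ℝ] H) (P : ℝ≥0 → H →L[ℝ] H) : Prop where
  semigroup : IsContractionSemigroup P
  mem_graph_iff : ∀ f g, (f, g) ∈ L.graph ↔
    Tendsto (fun t : ℝ≥0 => (t : ℝ)⁻¹ • (P t f - f)) (𝓝[>] 0) (𝓝 g)

variable [CompleteSpace H]

/-- The symmetric part `𝒮 = (ℒ + ℒ*) / 2`, with domain `C`. -/
def symPart (L : H →ₗ.[ℝ] H) (C : Submodule ℝ H) : H →ₗ.[ℝ] H :=
  ((1 / 2 : ℝ) • (L + L†)).domRestrict C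

/-- The antisymmetric part `𝒯 = (ℒ - ℒ*) / 2`, with domain `C`. -/
def antisymPart (L : H →ₗ.[ℝ] H) (C : Submodule ℝ H) : H →ₗ.[ℝ] H :=
  ((1 / 2 : ℝ) • (L - L†)).domRestrict C

/-- The operator `𝒯 Π`, with domain `{f : Π f ∈ C}`. -/
def TPi (L : H →ₗ.[ℝ] H) (C : Submodule ℝ H) (Pv : H →L[ℝ] H) : H →ₗ.[ℝ] H :=
  pcomp (antisymPart L C) ((Pv : H →ₗ[ℝ] H).toPMap ⊤)

/-- `G = (𝒯 Π)* (closure of 𝒯 Π)`, with its natural domain. -/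
def opG (L : H →ₗ.[ℝ] H) (C : Submodule ℝ H) (Pv : H →L[ℝ] H) : H →ₗ.[ℝ] H :=
  pcomp (TPi L C Pv)† (TPi L C Pv).closure

/-- `𝒜 = (m₂ Id + G)⁻¹ (-𝒯 Π)*`, with domain `D((𝒯 Π)*)`. -/
def opA (m₂ : ℝ) (L : H →ₗ.[ℝ] H) (C : Submodule ℝ H) (Pv : H →L[ℝ] H) : H →ₗ.[ℝ] H :=
  pcomp ((m₂ • (LinearMap.id : H →ₗ[ℝ] H)).toPMap ⊤ + opG L C Pv).inverse (-(TPi L C Pv))†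

end Hilbert

/-! ### The space `L²(π ⊗ ν)` and the velocity average -/

section L2

variable {X V : Type*} [MeasurableSpace X] [MeasurableSpace V]
  (π : Measure X) (ν : Measure V) [IsProbabilityMeasure π] [IsProbabilityMeasure ν]

/-- The Hilbert space `L²(π ⊗ ν)` of real functions. -/
abbrev L2 : Type _ := Lp ℝ 2 (π.prod ν)

variable {π ν}

theorem stronglyMeasurable_avg (f : L2 π ν) :
    StronglyMeasurable (fun z : X × V => ∫ w, f (z.1, w) ∂ν) :=
  ((Lp.stronglyMeasurable f).integral_prod_right' (ν := ν)).comp_measurable measurable_fst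

theorem eLpNorm_avg_le (f : L2 π ν) :
    eLpNorm (fun z : X × V => ∫ w, f (z.1, w) ∂ν) 2 (π.prod ν) ≤ eLpNorm f 2 (π.prod ν) := by
  have hm : Measurable (fun z : X × V => ‖f z‖ₑ ^ (2 : ℝ)) :=
    ((Lp.stronglyMeasurable f).measurable.enorm).pow_const _
  rw [eLpNorm_eq_lintegral_rpow_enorm_toReal (by norm_num) (by norm_num),
    eLpNorm_eq_lintegral_rpow_enorm_toReal (by norm_num) (by norm_num)]
  refine ENNReal.rpow_le_rpow ?_ (by norm_num)
  simp only [ENNReal.toReal_ofNat]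
  have key : ∀ x, ‖∫ w, f (x, w) ∂ν‖ₑ ^ (2 : ℝ) ≤ ∫⁻ w, ‖f (x, w)‖ₑ ^ (2 : ℝ) ∂ν := by
    intro x
    have hsm : AEStronglyMeasurable (fun w => f (x, w)) ν :=
      ((Lp.stronglyMeasurable f).comp_measurable measurable_prodMk_left).aestronglyMeasurable
    have h1 : ‖∫ w, f (x, w) ∂ν‖ₑ ≤ eLpNorm (fun w => f (x, w)) 1 ν := by
      rw [eLpNorm_one_eq_lintegral_enorm]
      exact enorm_integral_le_lintegral_enorm _
    have h2 : eLpNorm (fun w => f (x, w)) 1 ν ≤ eLpNorm (fun w => f (x, w)) 2 ν :=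
      eLpNorm_le_eLpNorm_of_exponent_le (by norm_num) hsm
    have h3 := ENNReal.rpow_le_rpow (h1.trans h2) (by norm_num : (0 : ℝ) ≤ 2)
    refine h3.trans (le_of_eq ?_)
    rw [eLpNorm_eq_lintegral_rpow_enorm_toReal (by norm_num) (by norm_num),
      ← ENNReal.rpow_mul]
    simp
  calc ∫⁻ z, ‖∫ w, f (z.1, w) ∂ν‖ₑ ^ (2 : ℝ) ∂(π.prod ν)
      ≤ ∫⁻ z, (∫⁻ w, ‖f (z.1, w)‖ₑ ^ (2 : ℝ) ∂ν) ∂(π.prod ν) := lintegral_mono fun z => key z.1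
    _ = ∫⁻ x, ∫⁻ _v, (∫⁻ w, ‖f (x, w)‖ₑ ^ (2 : ℝ) ∂ν) ∂ν ∂π := by
        rw [lintegral_prod]
        exact (hm.lintegral_prod_right'.comp measurable_fst).aemeasurable
    _ = ∫⁻ z, ‖f z‖ₑ ^ (2 : ℝ) ∂(π.prod ν) := by
        rw [lintegral_prod _ hm.aemeasurable]
        simp

theorem memLp_avg (f : L2 π ν) :
    MemLp (fun z : X × V => ∫ w, f (z.1, w) ∂ν) 2 (π.prod ν) :=
  ⟨(stronglyMeasurable_avg f).aestronglyMeasurable,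
    (eLpNorm_avg_le f).trans_lt (Lp.eLpNorm_lt_top f)⟩

theorem ae_integrable_section (f : L2 π ν) :
    ∀ᵐ x ∂π, Integrable (fun w => f (x, w)) ν :=
  ((Lp.memLp f).integrable (by norm_num)).prod_right_ae

theorem ae_fst {p : X → Prop} (h : ∀ᵐ x ∂π, p x) : ∀ᵐ z ∂(π.prod ν), p z.1 :=
  Measure.quasiMeasurePreserving_fst.ae h

variable (π ν) in
/-- The velocity average `(Π_v f)(x, v) = ∫ f(x, w) dν(w)`, as a bounded operator on
`L²(π ⊗ ν)`. -/
def velocityAverage : L2 π ν →L[ℝ] L2 π ν :=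
  LinearMap.mkContinuous
    { toFun := fun f => (memLp_avg f).toLp (fun z : X × V => ∫ w, f (z.1, w) ∂ν)
      map_add' := by
        intro f g
        rw [← MemLp.toLp_add (memLp_avg f) (memLp_avg g)]
        refine MemLp.toLp_congr _ _ ?_
        have h := Measure.ae_ae_of_ae_prod (Lp.coeFn_add f g)
        filter_upwards [ae_fst (ν := ν) h, ae_fst (ν := ν) (ae_integrable_section f),
          ae_fst (ν := ν) (ae_integrable_section g)] with z hz hf hg
        rw [integral_congr_ae hz]
        exact integral_add hf hg
      map_smul' := by
        intro c f
        rw [RingHom.id_apply, ← MemLp.toLp_const_smul c (memLp_avg f)]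
        refine MemLp.toLp_congr _ _ ?_
        have h := Measure.ae_ae_of_ae_prod (Lp.coeFn_smul c f)
        filter_upwards [ae_fst (ν := ν) h] with z hz
        rw [integral_congr_ae hz]
        exact integral_smul c _ }
    1 (by
      intro f
      rw [one_mul, Lp.norm_def f]
      change ‖(memLp_avg f).toLp (fun z : X × V => ∫ w, f (z.1, w) ∂ν)‖ ≤ _
      rw [Lp.norm_toLp]
      exact ENNReal.toReal_mono (Lp.eLpNorm_ne_top f) (eLpNorm_avg_le f))

theorem coeFn_velocityAverage (f : L2 π ν) :
    velocityAverage π ν f =ᵐ[π.prod ν] fun z => ∫ w, f (z.1, w) ∂ν :=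
  (memLp_avg f).coeFn_toLp

variable (π ν) in
/-- The constant function equal to the mean `μ(f)`, `μ = π ⊗ ν`, as an element of `L²(μ)`. -/
def meanL2 (f : L2 π ν) : L2 π ν := Lp.const 2 (π.prod ν) (∫ z, f z ∂(π.prod ν))

/-! ### The conditions -/

/-- Basic condition: `ℒ` is closed and generates the strongly continuous contraction semigroup
`P`, `μ = π ⊗ ν` is stationary for `P`, and `C` is a core of `ℒ` which is dense in `L²(μ)` and
contained in `D(ℒ) ∩ D(ℒ*)`. -/
structure CoreCondition (L : L2 π ν →ₗ.[ℝ] L2 π ν) (P : ℝ≥0 → L2 π ν →L[ℝ] L2 π ν)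
    (C : Submodule ℝ (L2 π ν)) : Prop where
  isClosed : L.IsClosed
  generates : Generates L P
  stationary : ∀ t f, ∫ z, P t f z ∂(π.prod ν) = ∫ z, f z ∂(π.prod ν)
  core : L.HasCore C
  dense : Dense (C : Set (L2 π ν))
  le_adjoint_domain : C ≤ L†.domain

/-- Projection condition: `Ran Π_v ⊆ Ker 𝒮*`, and `Π_v 𝒯 Π_v = 0` on `C`. -/
structure ProjectionCondition (L : L2 π ν →ₗ.[ℝ] L2 π ν) (C : Submodule ℝ (L2 π ν)) : Prop where
  range_le_ker : ∀ f, ∃ h : velocityAverage π ν f ∈ (symPart L C)†.domain,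
    (symPart L C)† ⟨velocityAverage π ν f, h⟩ = 0
  proj_T_proj : ∀ f ∈ C,
    velocityAverage π ν (val (antisymPart L C) (velocityAverage π ν f)) = 0

/-- Remainder condition with constant `R₀`. -/
def RemainderCondition (m₂ R₀ : ℝ) (L : L2 π ν →ₗ.[ℝ] L2 π ν) (C : Submodule ℝ (L2 π ν)) : Prop :=
  ∀ f ∈ C,
    |⟪val (opA m₂ L C (velocityAverage π ν)).closure
          (val (antisymPart L C) (f - velocityAverage π ν f)), f⟫_ℝ
        + ⟪val (opA m₂ L C (velocityAverage π ν)).closure (val (symPart L C) f), f⟫_ℝ|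
      ≤ R₀ * ‖f - velocityAverage π ν f‖ * ‖velocityAverage π ν f‖

/-- The conditions on the functional `Ψ : L²(μ) → [0, ∞]`. The semigroup `(e^{-tG})` is the
strongly continuous contraction semigroup with generator `-G`. -/
structure PsiCondition (L : L2 π ν →ₗ.[ℝ] L2 π ν) (P : ℝ≥0 → L2 π ν →L[ℝ] L2 π ν)
    (C : Submodule ℝ (L2 π ν)) (Ψ : L2 π ν → ℝ≥0∞) : Prop where
  dense_finite : Dense {f : L2 π ν | Ψ f < ∞}
  approx : ∀ f ∈ L.domain, ∃ u : ℕ → L2 π ν, (∀ n, u n ∈ C) ∧ Tendsto u atTop (𝓝 f) ∧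
    limsup (fun n => ((⟪-val L (u n), u n⟫_ℝ : ℝ) : EReal)) atTop
      ≤ ((⟪-val L f, f⟫_ℝ : ℝ) : EReal) ∧
    limsup (fun n => Ψ (u n)) atTop ≤ Ψ f
  semigroup_le : ∀ t f, Ψ (P t f) ≤ Ψ f
  exp_le : ∀ Q : ℝ≥0 → L2 π ν →L[ℝ] L2 π ν, Generates (-opG L C (velocityAverage π ν)) Q →
    ∀ t f, Ψ (Q t f) ≤ Ψ f
  proj_le : ∀ f, Ψ (velocityAverage π ν f) ≤ Ψ f

/-- The two weak Poincaré inequalities, with decreasing `α₁, α₂ : (0, ∞) → [1, ∞)`; the first one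
is required on the domain of the closure of `𝒯 Π_v`. -/
structure WeakPoincareCondition (L : L2 π ν →ₗ.[ℝ] L2 π ν) (C : Submodule ℝ (L2 π ν))
    (Ψ : L2 π ν → ℝ≥0∞) (α₁ α₂ : ℝ → ℝ) : Prop where
  anti₁ : AntitoneOn α₁ (Ioi 0)
  anti₂ : AntitoneOn α₂ (Ioi 0)
  one_le₁ : ∀ r, 0 < r → 1 ≤ α₁ r
  one_le₂ : ∀ r, 0 < r → 1 ≤ α₂ r
  wp₁ : ∀ f ∈ (TPi L C (velocityAverage π ν)).closure.domain, ∀ r, 0 < r →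
    ENNReal.ofReal (‖velocityAverage π ν f - meanL2 π ν f‖ ^ 2)
      ≤ ENNReal.ofReal (α₁ r * ‖val (TPi L C (velocityAverage π ν)).closure f‖ ^ 2)
        + ENNReal.ofReal r * Ψ (velocityAverage π ν f)
  wp₂ : ∀ f ∈ C, ∀ r, 0 < r →
    ENNReal.ofReal (‖f - velocityAverage π ν f‖ ^ 2)
      ≤ ENNReal.ofReal (α₂ r * ⟪-val (symPart L C) f, f⟫_ℝ) + ENNReal.ofReal r * Ψ f

end L2

/-! ### The rate and the constants -/

/-- `ξ(t) = c₁ inf {r > 0 : c₂ t ≥ α₁(r)² α₂(r / α₁(r)²) log(1/r)}`. -/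
def xi (α₁ α₂ : ℝ → ℝ) (c₁ c₂ t : ℝ) : ℝ :=
  c₁ * sInf {r : ℝ | 0 < r ∧ c₂ * t ≥ α₁ r ^ 2 * α₂ (r / α₁ r ^ 2) * Real.log (1 / r)}

/-- `ε(r) = 1 / (α₂(r / α₁(r)²) [R₀² (α₁(r) + m₂) + 2])`. -/
def epsAt (α₁ α₂ : ℝ → ℝ) (R₀ m₂ r : ℝ) : ℝ :=
  1 / (α₂ (r / α₁ r ^ 2) * (R₀ ^ 2 * (α₁ r + m₂) + 2))

/-- `ε = sup_{r > 0} ε(r)`. -/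
def eps (α₁ α₂ : ℝ → ℝ) (R₀ m₂ : ℝ) : ℝ := sSup (epsAt α₁ α₂ R₀ m₂ '' Ioi 0)

/-- The explicit constant `c₁`, as a function of `ε`. -/
def const₁ (R₀ m₂ ε : ℝ) : ℝ :=
  2 * max ((1 + ε * (m₂ / 2) ^ (-(1 / 2) : ℝ)) / 2)
      ((2 + (m₂ / 2) ^ (-(1 / 2) : ℝ)) * (R₀ ^ 2 * (1 + m₂) ^ 2 + 1))
    / (1 - ε * (m₂ / 2) ^ (-(1 / 2) : ℝ))

/-- The explicit constant `c₂`. -/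
def const₂ (R₀ m₂ : ℝ) : ℝ :=
  1 / (R₀ ^ 2 * (2 + (m₂ / 2) ^ (-(1 / 2) : ℝ)) * (1 + m₂) ^ 2)

/-- `‖P_t f - μ(f)‖² ≤ ξ(t) (‖f‖² + Ψ(f))` for all `t ≥ 0` and `f ∈ D(ℒ)`. -/
def DecayBound {X V : Type*} [MeasurableSpace X] [MeasurableSpace V]
    {π : Measure X} {ν : Measure V} [IsProbabilityMeasure π] [IsProbabilityMeasure ν]
    (L : L2 π ν →ₗ.[ℝ] L2 π ν) (P : ℝ≥0 → L2 π ν →L[ℝ] L2 π ν)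
    (Ψ : L2 π ν → ℝ≥0∞) (ξ : ℝ → ℝ) : Prop :=
  ∀ t : ℝ≥0, ∀ f ∈ L.domain,
    ENNReal.ofReal (‖P t f - meanL2 π ν f‖ ^ 2)
      ≤ ENNReal.ofReal (ξ t) * (ENNReal.ofReal (‖f‖ ^ 2) + Ψ f)

end Hypocoercivity

end

/-! The proof is the L² hypocoercivity method, run with weak Poincaré inequalities. Write Π for the
velocity average, `x = ‖f - Πf‖` and `y = ‖Πf‖` for `f` of mean zero, and `K = G (m₂ + G)⁻¹`. The
dissipation `⟪-ℒf, f⟫` controls only `x`, so `‖f‖² / 2` is replaced by the entropy `‖f‖² / 2 + δ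
⟪𝒜f, f⟫`. The two are comparable for small `δ`, because `|⟪𝒜f, f⟫| ≤ x y / (2 √m₂)`.

Since 𝒮Π = 0 and 𝒜𝒯Π = -K, the remainder condition gives `⟪𝒜ℒf, f⟫ ≤ -⟪Kf, f⟫ + R₀ x y`
(`remainder_le`), while `⟪𝒜f, ℒf⟫ ≤ x²` (`inner_A_le`). The operators 𝒜 and K being bounded, both
bounds pass from the core to all of D(ℒ), hence to the orbit of any `f` in D(ℒ).

The missing control of `y` is `y² ≤ (1 + m₂ α₁(r)) ⟪Kf, f⟫ + r Ψ(f)` (`norm_sq_le_inner_K`). It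
comes from applying the first weak Poincaré inequality along `e^{-tG} f`, where Ψ does not increase.
A Grönwall argument backwards in time then transfers the inequality from G to K. This needs the
semigroup `e^{-tG}` itself: von Neumann's theorem makes G self-adjoint, Yosida approximation builds
the semigroup, and its smoothing effect puts the orbit into D(G) at positive times.

Together these bounds give `d/dt Ent ≤ -l Ent + θ`, with `θ` proportional to `Ψ(f)`. For fixed `r`
the choices `a = α₂(r / α₁(r)²)`, `b = 1 + m₂ α₁(r)` and `δ` of order `1 / (a b)` make `θ / l` of
order `r Ψ(f)` and `l` at least of order `1 / (α₁² α₂)`. Once `t` passes the threshold in the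
definition of ξ, the exponential is at most `r`; the infimum over `r` gives ξ. -/

noncomputable section

namespace Hypocoercivity

/-! ### Semigroups of bounded nonnegative operators, with bounds independent of the operator norm.
-/

section BoundedSemigroup

variable {H : Type*} [NormedAddCommGroup H] [InnerProductSpace ℝ H]

/-- The uniformly continuous semigroup `e^{-tM}` of a bounded operator. -/
def expNeg (M : H →L[ℝ] H) (t : ℝ) : H →L[ℝ] H := NormedSpace.exp (t • (-M))

@[simp] theorem expNeg_zero_right (M : H →L[ℝ] H) : expNeg M 0 = 1 := by
  simp [expNeg]

@[simp] theorem expNeg_zero_left (t : ℝ) : expNeg (0 : H →L[ℝ] H) t = 1 := by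
  simp [expNeg]

theorem commute_expNeg {M N : H →L[ℝ] H} (h : Commute M N) (t : ℝ) : Commute (expNeg M t) N :=
  (h.neg_left.smul_left t).exp_left

variable [CompleteSpace H]

theorem expNeg_add (M : H →L[ℝ] H) (s t : ℝ) : expNeg M (s + t) = expNeg M s * expNeg M t := by
  let : NormedAlgebra ℚ (H →L[ℝ] H) := NormedAlgebra.restrictScalars ℚ ℝ _
  rw [expNeg, add_smul]
  exact NormedSpace.exp_add_of_commute (((Commute.refl (-M)).smul_left s).smul_right t)

theorem hasDerivAt_expNeg (M : H →L[ℝ] H) (t : ℝ) :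
    HasDerivAt (expNeg M) (-(M * expNeg M t)) t := by
  have := hasDerivAt_exp_smul_const' (-M) t
  rw [neg_mul] at this
  exact this

theorem hasDerivAt_expNeg_apply (M : H →L[ℝ] H) (x : H) (t : ℝ) :
    HasDerivAt (fun t => expNeg M t x) (-M (expNeg M t x)) t := by
  have := (hasDerivAt_expNeg M t).clm_apply (hasDerivAt_const t x)
  simpa using this

theorem norm_expNeg_apply_le {M : H →L[ℝ] H} (hM : ∀ x, 0 ≤ ⟪M x, x⟫_ℝ) {t : ℝ} (ht : 0 ≤ t)
    (x : H) : ‖expNeg M t x‖ ≤ ‖x‖ := by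
  have h1 : Antitone (fun t => ‖expNeg M t x‖ ^ 2) := by
    refine antitone_of_hasDerivAt_nonpos (fun t => (hasDerivAt_expNeg_apply M x t).norm_sq) ?_
    intro t
    simp only [inner_neg_right]
    have := hM (expNeg M t x)
    rw [real_inner_comm] at this
    simpa using this
  have h2 := h1 ht
  simp only [expNeg_zero_right, one_apply_eq_self] at h2
  exact le_of_sq_le_sq h2 (norm_nonneg _)

/-- Duhamel's formula: commutation makes the derivative of `s ↦ e^{-sM} e^{-(t-s)N} x` equal to
`e^{-sM} e^{-(t-s)N} (N - M) x`, and both semigroups are contractions. -/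
theorem norm_expNeg_sub_expNeg_le {M N : H →L[ℝ] H} (hM : ∀ x, 0 ≤ ⟪M x, x⟫_ℝ)
    (hN : ∀ x, 0 ≤ ⟪N x, x⟫_ℝ) (hMN : Commute M N) {t : ℝ} (ht : 0 ≤ t) (x : H) :
    ‖expNeg M t x - expNeg N t x‖ ≤ t * ‖M x - N x‖ := by
  have hd : ∀ s, HasDerivAt (fun s => expNeg M s (expNeg N (t - s) x))
      (expNeg M s (expNeg N (t - s) (N x - M x))) s := by
    intro s
    have h1 := (hasDerivAt_expNeg_apply N x (t - s)).scomp s ((hasDerivAt_id s).const_sub t)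
    have h2 := (hasDerivAt_expNeg M s).clm_apply h1
    refine h2.congr_deriv ?_
    have e1 := fun y => DFunLike.congr_fun (commute_expNeg (Commute.refl M) s).eq y
    have e2 := fun y => DFunLike.congr_fun (commute_expNeg (Commute.refl N) (t - s)).eq y
    have e3 := fun y => DFunLike.congr_fun (commute_expNeg hMN.symm (t - s)).eq y
    simp only [mul_apply_eq_comp] at e1 e2 e3
    simp only [neg_smul, one_smul, neg_neg, neg_apply,
      mul_apply_eq_comp, Function.comp_apply, map_sub]
    rw [← e1, e2, e3]
    abel
  have := norm_image_sub_le_of_norm_deriv_le_segment' (a := 0) (b := t) (C := ‖M x - N x‖)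
    (fun s _ => (hd s).hasDerivWithinAt) (fun s hs => by
      refine (norm_expNeg_apply_le hM hs.1 _).trans ?_
      refine (norm_expNeg_apply_le hN (by linarith [hs.2]) _).trans ?_
      rw [norm_sub_rev]) t (right_mem_Icc.2 ht)
  simpa [mul_comm] using this

theorem norm_expNeg_sub_self_le {M : H →L[ℝ] H} (hM : ∀ x, 0 ≤ ⟪M x, x⟫_ℝ) {t : ℝ} (ht : 0 ≤ t)
    (x : H) : ‖expNeg M t x - x‖ ≤ t * ‖M x‖ := by
  simpa using norm_expNeg_sub_expNeg_le hM (N := 0) (by simp) (Commute.zero_right M) ht x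

/-- The remainder has derivative `Mx - e^{-sM} Mx`. Replacing `Mx` by a nearby `z` leaves `‖Mz‖`
instead of `‖M²x‖`, so the bound survives the limit along Yosida approximations when `z` lies in the
domain of the limit. -/
theorem norm_expNeg_sub_add_le {M : H →L[ℝ] H} (hM : ∀ x, 0 ≤ ⟪M x, x⟫_ℝ) {t : ℝ} (ht : 0 ≤ t)
    (x z : H) : ‖expNeg M t x - x + t • M x‖ ≤ (2 * ‖M x - z‖ + t * ‖M z‖) * t := by
  have hd : ∀ s, HasDerivAt (fun s => expNeg M s x + s • M x) (M x - expNeg M s (M x)) s := by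
    intro s
    have h := (hasDerivAt_expNeg_apply M x s).add ((hasDerivAt_id s).smul_const (M x))
    refine h.congr_deriv ?_
    have e1 := DFunLike.congr_fun (commute_expNeg (Commute.refl M) s).eq x
    simp only [mul_apply_eq_comp] at e1
    rw [e1, one_smul]; abel
  have := norm_image_sub_le_of_norm_deriv_le_segment' (a := 0) (b := t)
    (C := 2 * ‖M x - z‖ + t * ‖M z‖)
    (fun s _ => (hd s).hasDerivWithinAt) (fun s hs => by
      have h1 : M x - expNeg M s (M x)
          = (M x - z) - expNeg M s (M x - z) - (expNeg M s z - z) := by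
        simp only [map_sub]; abel
      rw [h1]
      refine (norm_sub_le _ _).trans ?_
      have h2 := norm_sub_le (M x - z) (expNeg M s (M x - z))
      have h3 := norm_expNeg_apply_le hM hs.1 (M x - z)
      have h4 := norm_expNeg_sub_self_le hM hs.1 z
      have h5 := mul_le_mul_of_nonneg_right hs.2.le (norm_nonneg (M z))
      linarith) t (right_mem_Icc.2 ht)
  have h6 : expNeg M t x + t • M x - (expNeg M 0 x + (0 : ℝ) • M x)
      = expNeg M t x - x + t • M x := by
    simp; abel
  rw [h6] at this
  simpa using this

/-- The smoothing estimate of self-adjoint semigroups: the functional `‖u‖² + 2s ⟪Mu, u⟫ + 2s²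
‖Mu‖²` decreases along `u' = -Mu`, because all terms of its derivative cancel except `-4s² ⟪M(Mu),
Mu⟫`. -/
theorem mul_norm_apply_expNeg_le {M : H →L[ℝ] H} (hM : ∀ x, 0 ≤ ⟪M x, x⟫_ℝ)
    (hsymm : ∀ x y, ⟪M x, y⟫_ℝ = ⟪x, M y⟫_ℝ) {t : ℝ} (ht : 0 ≤ t) (x : H) :
    t * ‖M (expNeg M t x)‖ ≤ ‖x‖ := by
  set u := fun t => expNeg M t x with hu
  have hd : ∀ s, HasDerivAt u (-M (u s)) s := hasDerivAt_expNeg_apply M x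
  have hMd : ∀ s, HasDerivAt (fun s => M (u s)) (M (-M (u s))) s :=
    fun s => M.hasFDerivAt.comp_hasDerivAt s (hd s)
  have key : ∀ s, HasDerivAt
      (fun s => ‖u s‖ ^ 2 + 2 * s * ⟪M (u s), u s⟫_ℝ + 2 * s ^ 2 * ‖M (u s)‖ ^ 2)
      (-(4 * s ^ 2 * ⟪M (M (u s)), M (u s)⟫_ℝ)) s := by
    intro s
    have h := ((hd s).norm_sq.add (((hasDerivAt_id s).const_mul 2).mul
      ((hMd s).inner ℝ (hd s)))).add ((((hasDerivAt_id s).pow 2).const_mul 2).mul (hMd s).norm_sq)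
    refine h.congr_deriv ?_
    simp only [inner_neg_right, map_neg, inner_neg_left, id, Pi.pow_apply]
    rw [hsymm (M (u s)) (u s), real_inner_self_eq_norm_sq, real_inner_comm (M (M (u s))),
      real_inner_comm (u s) (M (u s))]
    push_cast
    ring
  have hanti : AntitoneOn
      (fun s => ‖u s‖ ^ 2 + 2 * s * ⟪M (u s), u s⟫_ℝ + 2 * s ^ 2 * ‖M (u s)‖ ^ 2) univ := by
    refine Antitone.antitoneOn (antitone_of_hasDerivAt_nonpos key fun s => ?_) _
    have := hM (M (u s))
    simp only [Pi.zero_apply, neg_nonpos]; positivity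
  have h1 := hanti (mem_univ 0) (mem_univ t) ht
  simp only [hu, expNeg_zero_right, one_apply_eq_self] at h1
  have h2 := mul_nonneg ht (hM (expNeg M t x))
  refine le_of_sq_le_sq ?_ (norm_nonneg _)
  rw [mul_pow]
  nlinarith [sq_nonneg (‖expNeg M t x‖), sq_nonneg (t * ‖M (expNeg M t x)‖)]

end BoundedSemigroup

/-! ### Resolvents and Yosida approximations of nonnegative self-adjoint operators. -/

section Resolvent

variable {H : Type*} [NormedAddCommGroup H] [InnerProductSpace ℝ H]

/-- `G` is nonnegative and symmetric, and `l + G` is onto for every `l > 0`; equivalently, `G` is a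
nonnegative self-adjoint operator. -/
structure IsNonnegSelfAdjoint (G : H →ₗ.[ℝ] H) : Prop where
  nonneg : ∀ p ∈ G.graph, 0 ≤ ⟪p.2, p.1⟫_ℝ
  symm : ∀ p ∈ G.graph, ∀ q ∈ G.graph, ⟪p.2, q.1⟫_ℝ = ⟪p.1, q.2⟫_ℝ
  surj : ∀ l : ℝ, 0 < l → ∀ h, ∃ p ∈ G.graph, l • p.1 + p.2 = h

namespace IsNonnegSelfAdjoint

variable {G : H →ₗ.[ℝ] H} (hG : IsNonnegSelfAdjoint G)

include hG

theorem norm_le {l : ℝ} {p : H × H} (hp : p ∈ G.graph) :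
    l * ‖p.1‖ ≤ ‖l • p.1 + p.2‖ := by
  have h1 := hG.nonneg p hp
  have h2 : l * ‖p.1‖ ^ 2 ≤ ‖l • p.1 + p.2‖ * ‖p.1‖ := by
    refine le_trans ?_ (real_inner_le_norm _ _)
    rw [inner_add_left, real_inner_smul_left, real_inner_self_eq_norm_sq]
    linarith
  rcases (norm_nonneg p.1).eq_or_lt with h | h
  · rw [← h]; simp
  · nlinarith

theorem fst_eq {l : ℝ} (hl : 0 < l) {p q : H × H} (hp : p ∈ G.graph) (hq : q ∈ G.graph)
    (h : l • p.1 + p.2 = l • q.1 + q.2) : p.1 = q.1 := by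
  have h1 := hG.norm_le (l := l) (G.graph.sub_mem hp hq)
  have h2 : l • (p - q).1 + (p - q).2 = 0 := by
    rw [Prod.fst_sub, Prod.snd_sub, smul_sub]
    rw [← sub_eq_zero] at h
    rw [← h]; abel
  rw [h2, norm_zero] at h1
  have h3 : ‖(p - q).1‖ = 0 := le_antisymm (by nlinarith [norm_nonneg (p - q).1]) (norm_nonneg _)
  exact sub_eq_zero.1 (norm_eq_zero.1 h3)

theorem exists_resolvent {l : ℝ} (hl : 0 < l) :
    ∃ R : H →L[ℝ] H, ∀ h, (R h, h - l • R h) ∈ G.graph := by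
  choose p hp hph using hG.surj l hl
  have hmem : ∀ h, ((p h).1, h - l • (p h).1) ∈ G.graph := by
    intro h
    have := hp h
    rwa [← Prod.mk.eta (p := p h), eq_sub_of_add_eq' (hph h)] at this
  refine ⟨LinearMap.mkContinuous
    { toFun := fun h => (p h).1
      map_add' := fun h k => hG.fst_eq hl (hp _) (G.graph.add_mem (hp h) (hp k)) ?_
      map_smul' := fun c h => hG.fst_eq hl (hp _) (G.graph.smul_mem c (hp h)) ?_ } l⁻¹ ?_, hmem⟩
  · rw [hph, Prod.fst_add, Prod.snd_add, smul_add, add_add_add_comm, hph, hph]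
  · rw [hph, Prod.smul_fst, Prod.smul_snd, smul_comm l c, ← smul_add, hph]
  · intro h
    rw [inv_mul_eq_div, le_div_iff₀ hl, mul_comm]
    simpa [hph] using hG.norm_le (l := l) (hp h)

/-- The resolvent `(l + G)⁻¹`, for `l > 0`. -/
def resolvent {l : ℝ} (hl : 0 < l) : H →L[ℝ] H := (hG.exists_resolvent hl).choose

variable {l m : ℝ} (hl : 0 < l) (hm : 0 < m)

theorem resolvent_mem_graph (h : H) : (hG.resolvent hl h, h - l • hG.resolvent hl h) ∈ G.graph :=
  (hG.exists_resolvent hl).choose_spec h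

theorem resolvent_add {x y : H} (hxy : (x, y) ∈ G.graph) : hG.resolvent hl (l • x + y) = x :=
  hG.fst_eq hl (hG.resolvent_mem_graph hl _) hxy (by simp)

theorem mul_norm_resolvent_le (h : H) : l * ‖hG.resolvent hl h‖ ≤ ‖h‖ := by
  simpa using hG.norm_le (l := l) (hG.resolvent_mem_graph hl h)

theorem inner_resolvent_left (h k : H) :
    ⟪hG.resolvent hl h, k⟫_ℝ = ⟪h, hG.resolvent hl k⟫_ℝ := by
  have := hG.symm _ (hG.resolvent_mem_graph hl h) _ (hG.resolvent_mem_graph hl k)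
  simp only [inner_sub_left, inner_sub_right, real_inner_smul_left, real_inner_smul_right] at this
  linarith

theorem resolvent_resolvent (h : H) :
    (m - l) • hG.resolvent hl (hG.resolvent hm h) = hG.resolvent hl h - hG.resolvent hm h := by
  have h1 := hG.resolvent_add hl
    (G.graph.sub_mem (hG.resolvent_mem_graph hl h) (hG.resolvent_mem_graph hm h))
  rw [← h1, ← map_smul]
  congr 1
  simp only [sub_smul, smul_sub]
  abel

theorem commute_resolvent : Commute (hG.resolvent hl) (hG.resolvent hm) := by
  rcases eq_or_ne m l with rfl | hne
  · exact Commute.refl _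
  ext h
  have h1 := hG.resolvent_resolvent hl hm h
  have h2 := hG.resolvent_resolvent hm hl h
  refine smul_right_injective H (sub_ne_zero.2 hne) ?_
  simp only [mul_apply_eq_comp]
  rw [h1, ← neg_sub l m, neg_smul, h2]
  abel

/-- The Yosida approximation `l (1 - l (l + G)⁻¹)` of `G`. -/
def yosida : H →L[ℝ] H := l • (1 - l • hG.resolvent hl)

theorem yosida_apply (h : H) : hG.yosida hl h = l • (h - l • hG.resolvent hl h) := rfl

theorem mem_graph_yosida (h : H) : (l • hG.resolvent hl h, hG.yosida hl h) ∈ G.graph :=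
  G.graph.smul_mem l (hG.resolvent_mem_graph hl h)

theorem yosida_apply_of_mem {x y : H} (hxy : (x, y) ∈ G.graph) :
    hG.yosida hl x = l • hG.resolvent hl y := by
  rw [yosida_apply]
  congr 1
  have := hG.resolvent_add hl hxy
  rw [map_add, map_smul] at this
  exact sub_eq_of_eq_add' this.symm

theorem norm_smul_resolvent_le (h : H) : ‖l • hG.resolvent hl h‖ ≤ ‖h‖ := by
  rw [norm_smul, Real.norm_of_nonneg hl.le]
  exact hG.mul_norm_resolvent_le hl h

theorem norm_yosida_le {x y : H} (hxy : (x, y) ∈ G.graph) : ‖hG.yosida hl x‖ ≤ ‖y‖ := by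
  rw [hG.yosida_apply_of_mem hl hxy]
  exact hG.norm_smul_resolvent_le hl y

theorem inner_yosida_nonneg (h : H) : 0 ≤ ⟪hG.yosida hl h, h⟫_ℝ := by
  rw [yosida_apply, real_inner_smul_left, inner_sub_left, real_inner_self_eq_norm_sq]
  have h1 := real_inner_le_norm (l • hG.resolvent hl h) h
  have h2 := mul_le_mul_of_nonneg_right (hG.norm_smul_resolvent_le hl h) (norm_nonneg h)
  refine mul_nonneg hl.le ?_
  nlinarith

theorem inner_yosida_left (h k : H) : ⟪hG.yosida hl h, k⟫_ℝ = ⟪h, hG.yosida hl k⟫_ℝ := by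
  simp only [yosida_apply, real_inner_smul_left, inner_sub_left, real_inner_smul_right,
    inner_sub_right, hG.inner_resolvent_left]

theorem commute_yosida : Commute (hG.yosida hl) (hG.yosida hm) := by
  refine Commute.smul_left (Commute.smul_right ?_ _) _
  refine Commute.sub_left (Commute.one_left _) ?_
  exact Commute.sub_right (Commute.one_right _)
    (((hG.commute_resolvent hl hm).smul_right _).smul_left _)

/-- If `h` is orthogonal to the domain, it is orthogonal to `(1 + G)⁻¹ h`; nonnegativity of G then
forces `(1 + G)⁻¹ h = 0`, hence `h = G 0 = 0`. -/
theorem dense_domain [CompleteSpace H] : Dense (G.domain : Set H) := by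
  rw [Submodule.dense_iff_topologicalClosure_eq_top,
    Submodule.topologicalClosure_eq_top_iff, Submodule.eq_bot_iff]
  intro h hh
  have h1 := hG.resolvent_mem_graph one_pos h
  have h2 := (Submodule.mem_orthogonal _ _).1 hh _ (LinearPMap.mem_domain_of_mem_graph h1)
  have h3 := hG.nonneg _ h1
  simp only [one_smul, inner_sub_left, real_inner_self_eq_norm_sq] at h3
  rw [real_inner_comm] at h2
  rw [h2, zero_sub, neg_nonneg] at h3
  have h4 : hG.resolvent one_pos h = 0 := by
    rw [← norm_eq_zero]; exact pow_eq_zero_iff two_ne_zero |>.1 (le_antisymm h3 (sq_nonneg _))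
  rw [h4] at h1
  simpa using G.graph_fst_eq_zero_snd h1 rfl

/-- G is closed because its resolvent is continuous. -/
theorem mem_graph_of_tendsto {u v : ℕ → H} {x y : H} (huv : ∀ n, (u n, v n) ∈ G.graph)
    (hu : Tendsto u atTop (𝓝 x)) (hv : Tendsto v atTop (𝓝 y)) : (x, y) ∈ G.graph := by
  have h1 : Tendsto (fun n => hG.resolvent one_pos ((1 : ℝ) • u n + v n)) atTop
      (𝓝 (hG.resolvent one_pos ((1 : ℝ) • x + y))) :=
    ((hG.resolvent one_pos).continuous.tendsto _).comp ((hu.const_smul _).add hv)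
  simp only [fun n => hG.resolvent_add one_pos (huv n)] at h1
  have h2 := tendsto_nhds_unique h1 hu
  have h3 := hG.resolvent_mem_graph one_pos ((1 : ℝ) • x + y)
  rw [h2] at h3
  simpa using h3

end IsNonnegSelfAdjoint

end Resolvent

/-! ### Passing from a dense set to the whole space under uniform bounds. -/

section Limits

variable {E F : Type*} [NormedAddCommGroup E] [NormedSpace ℝ E] [NormedAddCommGroup F]
  [NormedSpace ℝ F]

/-- Uniformly bounded operators which converge on a dense set to a bounded operator converge
everywhere. -/
theorem tendsto_of_tendsto_dense {ι : Type*} {l : Filter ι} {T : ι → E →L[ℝ] F} {S : E →L[ℝ] F}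
    {c : ℝ} (hT : ∀ n x, ‖T n x‖ ≤ c * ‖x‖) {D : Set E} (hD : Dense D)
    (h : ∀ x ∈ D, Tendsto (fun n => T n x) l (𝓝 (S x))) (x : E) :
    Tendsto (fun n => T n x) l (𝓝 (S x)) := by
  rw [Metric.tendsto_nhds]
  intro e he
  have hc : Continuous (fun y => |c| * ‖x - y‖ + ‖S y - S x‖) := by fun_prop
  obtain ⟨y, hyD, hy⟩ := hD.exists_mem_open (hc.isOpen_preimage _ (isOpen_Iio (a := e / 2)))
    ⟨x, by simp [he]⟩
  simp only [mem_preimage, mem_Iio] at hy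
  filter_upwards [Metric.tendsto_nhds.1 (h y hyD) (e / 2) (by positivity)] with n hn
  rw [dist_eq_norm] at hn ⊢
  have h1 : T n x - S x = T n (x - y) + (T n y - S y) + (S y - S x) := by
    rw [map_sub]; abel
  have h2 := (hT n (x - y)).trans (mul_le_mul_of_nonneg_right (le_abs_self c) (norm_nonneg _))
  rw [h1]
  refine (norm_add₃_le).trans_lt ?_
  linarith

/-- Uniformly bounded operators which converge on a dense set converge everywhere. -/
theorem cauchySeq_of_dense {T : ℕ → E →L[ℝ] F} {c : ℝ} (hT : ∀ n x, ‖T n x‖ ≤ c * ‖x‖)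
    {D : Set E} (hD : Dense D) (h : ∀ x ∈ D, CauchySeq (fun n => T n x)) (x : E) :
    CauchySeq (fun n => T n x) := by
  rw [Metric.cauchySeq_iff]
  intro e he
  have hc : Continuous (fun y => |c| * ‖x - y‖) := by fun_prop
  obtain ⟨y, hyD, hy⟩ := hD.exists_mem_open (hc.isOpen_preimage _ (isOpen_Iio (a := e / 4)))
    ⟨x, by simp [he]⟩
  simp only [mem_preimage, mem_Iio] at hy
  obtain ⟨N, hN⟩ := Metric.cauchySeq_iff.1 (h y hyD) (e / 2) (by positivity)
  refine ⟨N, fun m hm n hn => ?_⟩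
  have h0 := hN m hm n hn
  rw [dist_eq_norm] at h0 ⊢
  have h1 : T m x - T n x = T m (x - y) + (T m y - T n y) - T n (x - y) := by
    rw [map_sub, map_sub]; abel
  have h2 := fun n =>
    (hT n (x - y)).trans (mul_le_mul_of_nonneg_right (le_abs_self c) (norm_nonneg _))
  rw [h1]
  refine (norm_sub_le _ _).trans_lt ((add_le_add_left (norm_add_le _ _) _).trans_lt ?_)
  linarith [h2 m, h2 n]

end Limits

/-! ### Construction of the semigroup generated by a negative self-adjoint operator. -/

section HilleYosida

variable {H : Type*} [NormedAddCommGroup H] [InnerProductSpace ℝ H]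

theorem IsContractionSemigroup.norm_apply_le {P : ℝ≥0 → H →L[ℝ] H} (hP : IsContractionSemigroup P)
    (t : ℝ≥0) (x : H) : ‖P t x‖ ≤ ‖x‖ :=
  ((P t).le_opNorm x).trans (mul_le_of_le_one_left (norm_nonneg x) (hP.contraction t))

theorem IsContractionSemigroup.add_apply {P : ℝ≥0 → H →L[ℝ] H} (hP : IsContractionSemigroup P)
    (s t : ℝ≥0) (x : H) : P (s + t) x = P s (P t x) := by
  rw [hP.add]; rfl

theorem mem_graph_neg {G : H →ₗ.[ℝ] H} {x y : H} : (x, y) ∈ (-G).graph ↔ (x, -y) ∈ G.graph := by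
  rw [LinearPMap.neg_graph, Submodule.mem_map]
  constructor
  · rintro ⟨p, hp, hpe⟩
    obtain ⟨rfl, rfl⟩ := Prod.ext_iff.1 hpe
    simpa using hp
  · exact fun h => ⟨_, h, by simp⟩

namespace IsNonnegSelfAdjoint

variable {G : H →ₗ.[ℝ] H} (hG : IsNonnegSelfAdjoint G)

include hG

/-- On the domain, `x - l (l + G)⁻¹ x = (l + G)⁻¹ G x` has norm at most `‖Gx‖ / l`; contractivity
and density do the rest. -/
theorem tendsto_smul_resolvent [CompleteSpace H] (x : H) :
    Tendsto (fun n : ℕ => ((n : ℝ) + 1) • hG.resolvent n.cast_add_one_pos x) atTop (𝓝 x) := by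
  refine tendsto_of_tendsto_dense
    (T := fun n : ℕ => ((n : ℝ) + 1) • hG.resolvent n.cast_add_one_pos)
    (S := ContinuousLinearMap.id ℝ H) (c := 1)
    (fun n x => by rw [one_mul]; exact hG.norm_smul_resolvent_le n.cast_add_one_pos x)
    hG.dense_domain (fun x hx => ?_) x
  obtain ⟨y, hxy⟩ := LinearPMap.mem_domain_iff.1 hx
  rw [tendsto_iff_norm_sub_tendsto_zero]
  have h1 : Tendsto (fun n : ℕ => (1 / ((n : ℝ) + 1)) * ‖y‖) atTop (𝓝 0) := by
    simpa using tendsto_one_div_add_atTop_nhds_zero_nat.mul_const ‖y‖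
  refine squeeze_zero (fun n => norm_nonneg _) (fun n => ?_) h1
  have hn : (0 : ℝ) < n + 1 := n.cast_add_one_pos
  have h2 := hG.yosida_apply_of_mem hn hxy
  rw [yosida_apply] at h2
  have h3 := smul_right_injective H hn.ne' h2
  have h4 := hG.mul_norm_resolvent_le hn y
  rw [norm_sub_rev, one_div, inv_mul_eq_div, le_div_iff₀ hn, mul_comm]
  change _ * ‖x - ((n : ℝ) + 1) • hG.resolvent hn x‖ ≤ _
  rw [h3]; exact h4

theorem tendsto_yosida [CompleteSpace H] {x y : H} (hxy : (x, y) ∈ G.graph) :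
    Tendsto (fun n : ℕ => hG.yosida n.cast_add_one_pos x) atTop (𝓝 y) := by
  refine (hG.tendsto_smul_resolvent y).congr fun n => ?_
  rw [hG.yosida_apply_of_mem _ hxy]

variable [CompleteSpace H]

/-- The approximating semigroups generated by the Yosida approximations. -/
def approx (n : ℕ) (t : ℝ) : H →L[ℝ] H := expNeg (hG.yosida n.cast_add_one_pos) t

theorem norm_approx_le (n : ℕ) {t : ℝ} (ht : 0 ≤ t) (x : H) : ‖hG.approx n t x‖ ≤ 1 * ‖x‖ := by
  rw [one_mul]
  exact norm_expNeg_apply_le (hG.inner_yosida_nonneg _) ht x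

theorem cauchySeq_approx {t : ℝ} (ht : 0 ≤ t) (x : H) : CauchySeq fun n => hG.approx n t x := by
  refine cauchySeq_of_dense (fun n => hG.norm_approx_le n ht) hG.dense_domain (fun x hx => ?_) x
  obtain ⟨y, hxy⟩ := LinearPMap.mem_domain_iff.1 hx
  have h1 := (hG.tendsto_yosida hxy).cauchySeq
  rw [Metric.cauchySeq_iff] at h1 ⊢
  intro e he
  obtain ⟨N, hN⟩ := h1 (e / (t + 1)) (by positivity)
  refine ⟨N, fun m hm n hn => ?_⟩
  have h2 := hN m hm n hn
  rw [dist_eq_norm] at h2 ⊢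
  refine (norm_expNeg_sub_expNeg_le (hG.inner_yosida_nonneg _) (hG.inner_yosida_nonneg _)
    (hG.commute_yosida _ _) ht x).trans_lt ?_
  rw [lt_div_iff₀ (by positivity)] at h2
  nlinarith [norm_nonneg (hG.yosida (m.cast_add_one_pos (α := ℝ)) x
    - hG.yosida (n.cast_add_one_pos (α := ℝ)) x)]

theorem exists_limit_approx (t : ℝ≥0) :
    ∃ S : H →L[ℝ] H, ∀ x, Tendsto (fun n => hG.approx n t x) atTop (𝓝 (S x)) := by
  choose f hf using fun x => cauchySeq_tendsto_of_complete (hG.cauchySeq_approx t.2 x)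
  exact ⟨continuousLinearMapOfTendsto (fun n => hG.approx n t) (tendsto_pi_nhds.2 hf), hf⟩

/-- The contraction semigroup `e^{-tG}`. -/
def semigroup (t : ℝ≥0) : H →L[ℝ] H := (hG.exists_limit_approx t).choose

theorem tendsto_approx (t : ℝ≥0) (x : H) :
    Tendsto (fun n => hG.approx n t x) atTop (𝓝 (hG.semigroup t x)) :=
  (hG.exists_limit_approx t).choose_spec x

theorem norm_semigroup_apply_le (t : ℝ≥0) (x : H) : ‖hG.semigroup t x‖ ≤ ‖x‖ :=
  le_of_tendsto (hG.tendsto_approx t x).norm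
    (Eventually.of_forall fun n => by simpa using hG.norm_approx_le n t.2 x)

theorem norm_semigroup_sub_self_le {x y : H} (hxy : (x, y) ∈ G.graph) (t : ℝ≥0) :
    ‖hG.semigroup t x - x‖ ≤ t * ‖y‖ := by
  refine le_of_tendsto ((hG.tendsto_approx t x).sub_const x).norm (Eventually.of_forall fun n => ?_)
  exact (norm_expNeg_sub_self_le (hG.inner_yosida_nonneg _) t.2 x).trans
    (mul_le_mul_of_nonneg_left (hG.norm_yosida_le _ hxy) t.2)

/-- Taking `z` in the domain close to `y = Gx` makes the right-hand side `o(t)`, which identifies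
the derivative at `0`. -/
theorem norm_semigroup_sub_add_le {x y z w : H} (hxy : (x, y) ∈ G.graph) (hzw : (z, w) ∈ G.graph)
    (t : ℝ≥0) :
    ‖hG.semigroup t x - x + (t : ℝ) • y‖ ≤ (2 * ‖y - z‖ + t * ‖w‖) * t := by
  refine le_of_tendsto_of_tendsto
    (((hG.tendsto_approx t x).sub_const x).add ((hG.tendsto_yosida hxy).const_smul (t : ℝ))).norm
    ((((hG.tendsto_yosida hxy).sub_const z).norm.const_mul 2).add_const (t * ‖w‖) |>.mul_const
      (t : ℝ)) (Eventually.of_forall fun n => ?_)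
  refine (norm_expNeg_sub_add_le (hG.inner_yosida_nonneg _) t.coe_nonneg x z).trans ?_
  have := mul_le_mul_of_nonneg_left (hG.norm_yosida_le n.cast_add_one_pos hzw) t.coe_nonneg
  exact mul_le_mul_of_nonneg_right (by linarith) t.coe_nonneg

/-- The smoothing estimate bounds `Mₙ e^{-tMₙ}` by `1 / t` uniformly in the Yosida index, so these
operators converge strongly as soon as they do on the dense domain; closedness of G concludes. -/
theorem semigroup_mem_domain {t : ℝ≥0} (ht : 0 < t) (x : H) : hG.semigroup t x ∈ G.domain := by
  have ht' : (0 : ℝ) < t := ht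
  have hb : ∀ n x, ‖(hG.yosida n.cast_add_one_pos * hG.approx n t) x‖ ≤ (t : ℝ)⁻¹ * ‖x‖ := by
    intro n x
    rw [inv_mul_eq_div, le_div_iff₀ ht', mul_comm]
    exact mul_norm_apply_expNeg_le (hG.inner_yosida_nonneg _) (hG.inner_yosida_left _) t.2 x
  have hc : ∀ x, CauchySeq fun n => (hG.yosida n.cast_add_one_pos * hG.approx n t) x := by
    refine cauchySeq_of_dense hb hG.dense_domain fun x hx => ?_
    obtain ⟨y, hxy⟩ := LinearPMap.mem_domain_iff.1 hx
    -- On the domain `Mₙ` may be moved inside: `Mₙ e^{-tMₙ} x = e^{-tMₙ} Mₙ x`, which tends to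
    -- `e^{-tG} Gx`.
    have h1 : Tendsto (fun n => hG.approx n t (hG.yosida n.cast_add_one_pos x - y)
        + hG.approx n t y) atTop (𝓝 (0 + hG.semigroup t y)) := by
      refine Tendsto.add ?_ (hG.tendsto_approx t y)
      refine squeeze_zero_norm (fun n => hG.norm_approx_le n t.2 _) ?_
      simpa using ((hG.tendsto_yosida hxy).sub_const y).norm
    refine (h1.congr fun n => ?_).cauchySeq
    have e1 := DFunLike.congr_fun
      (commute_expNeg (Commute.refl (hG.yosida n.cast_add_one_pos)) t).eq x
    rw [map_sub, sub_add_cancel]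
    exact e1
  obtain ⟨z, hz⟩ := cauchySeq_tendsto_of_complete (hc x)
  refine LinearPMap.mem_domain_of_mem_graph
    (hG.mem_graph_of_tendsto (fun n => hG.mem_graph_yosida n.cast_add_one_pos (hG.approx n t x))
      ?_ hz)
  have h2 : Tendsto (fun n : ℕ => ((n : ℝ) + 1) • hG.resolvent n.cast_add_one_pos
      (hG.approx n t x - hG.semigroup t x) + ((n : ℝ) + 1) • hG.resolvent n.cast_add_one_pos
        (hG.semigroup t x)) atTop (𝓝 (0 + hG.semigroup t x)) := by
    refine Tendsto.add ?_ (hG.tendsto_smul_resolvent _)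
    refine squeeze_zero_norm (fun n => hG.norm_smul_resolvent_le n.cast_add_one_pos _) ?_
    simpa using ((hG.tendsto_approx t x).sub_const (hG.semigroup t x)).norm
  rw [zero_add] at h2
  refine h2.congr fun n => ?_
  rw [map_sub, smul_sub, sub_add_cancel]

theorem isContractionSemigroup : IsContractionSemigroup hG.semigroup where
  zero := by
    ext x
    exact tendsto_nhds_unique (hG.tendsto_approx 0 x) (by simp [approx])
  add s t := by
    ext x
    refine tendsto_nhds_unique (hG.tendsto_approx (s + t) x) ?_
    have h1 : Tendsto (fun n => hG.approx n s (hG.approx n t x - hG.semigroup t x)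
        + hG.approx n s (hG.semigroup t x)) atTop
        (𝓝 (0 + hG.semigroup s (hG.semigroup t x))) := by
      refine Tendsto.add ?_ (hG.tendsto_approx s _)
      refine squeeze_zero_norm (fun n => hG.norm_approx_le n s.2 _) ?_
      simpa using ((hG.tendsto_approx t x).sub_const (hG.semigroup t x)).norm
    rw [zero_add] at h1
    refine h1.congr fun n => ?_
    rw [map_sub, sub_add_cancel, NNReal.coe_add]
    exact (DFunLike.congr_fun (expNeg_add _ _ _) x).symm
  contraction t := ContinuousLinearMap.opNorm_le_bound _ zero_le_one fun x => by
    rw [one_mul]; exact hG.norm_semigroup_apply_le t x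
  strongly_continuous x := by
    refine tendsto_of_tendsto_dense (T := fun t => hG.semigroup t)
      (S := ContinuousLinearMap.id ℝ H) (c := 1)
      (fun t x => by rw [one_mul]; exact hG.norm_semigroup_apply_le t x) hG.dense_domain
      (fun x hx => ?_) x
    obtain ⟨y, hxy⟩ := LinearPMap.mem_domain_iff.1 hx
    rw [tendsto_iff_norm_sub_tendsto_zero]
    refine squeeze_zero (fun t => norm_nonneg _)
      (fun t => hG.norm_semigroup_sub_self_le hxy t) ?_
    have : Continuous fun t : ℝ≥0 => (t : ℝ) * ‖y‖ := by fun_prop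
    simpa using this.tendsto 0

theorem tendsto_div_semigroup {x y : H} (hxy : (x, y) ∈ G.graph) :
    Tendsto (fun t : ℝ≥0 => (t : ℝ)⁻¹ • (hG.semigroup t x - x)) (𝓝[>] 0) (𝓝 (-y)) := by
  rw [Metric.tendsto_nhds]
  intro e he
  have hc : Continuous fun z => 2 * ‖y - z‖ := by fun_prop
  obtain ⟨z, hzD, hz⟩ := hG.dense_domain.exists_mem_open
    (hc.isOpen_preimage _ (isOpen_Iio (a := e / 2))) ⟨y, by simp [he]⟩
  simp only [mem_preimage, mem_Iio] at hz
  obtain ⟨w, hzw⟩ := LinearPMap.mem_domain_iff.1 hzD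
  have hc' : Continuous fun t : ℝ≥0 => (t : ℝ) * ‖w‖ := by fun_prop
  have h1 : ∀ᶠ t : ℝ≥0 in 𝓝[>] 0, (t : ℝ) * ‖w‖ < e / 2 := by
    refine (hc'.tendsto' 0 0 (by simp)).eventually_lt_const (by positivity) |>.filter_mono
      nhdsWithin_le_nhds
  filter_upwards [h1, self_mem_nhdsWithin] with t ht ht0
  have ht0' : (0 : ℝ) < t := ht0
  have h2 := hG.norm_semigroup_sub_add_le hxy hzw t
  rw [dist_eq_norm]
  have h3 : (t : ℝ)⁻¹ • (hG.semigroup t x - x) - -y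
      = (t : ℝ)⁻¹ • (hG.semigroup t x - x + (t : ℝ) • y) := by
    rw [smul_add, smul_smul, inv_mul_cancel₀ ht0'.ne', one_smul, sub_neg_eq_add]
  rw [h3, norm_smul, norm_inv, Real.norm_of_nonneg ht0'.le, inv_mul_eq_div, div_lt_iff₀ ht0']
  refine h2.trans_lt ?_
  gcongr
  linarith

/-- **Hille–Yosida** for nonnegative self-adjoint operators. -/
theorem generates_semigroup : Generates (-G) hG.semigroup where
  semigroup := hG.isContractionSemigroup
  mem_graph_iff x z := by
    rw [mem_graph_neg]
    refine ⟨fun h => by simpa using hG.tendsto_div_semigroup h, fun h => ?_⟩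
    -- A generator has no proper extension that still satisfies the limit: the range condition
    -- supplies `p` in the graph of G such that `w = x - p.1` has right derivative `w` at `0`.
    -- Contractivity then forces `⟪w, w⟫ ≤ 0`.
    obtain ⟨p, hp, hpx⟩ := hG.surj 1 one_pos (x - z)
    have h1 := h.sub (hG.tendsto_div_semigroup hp)
    have h2 : Tendsto (fun t : ℝ≥0 => (t : ℝ)⁻¹ •
        (hG.semigroup t (x - p.1) - (x - p.1))) (𝓝[>] 0) (𝓝 (x - p.1)) := by
      have e1 : z - -p.2 = x - p.1 := by
        rw [one_smul] at hpx
        rw [sub_neg_eq_add, eq_sub_iff_add_eq, add_assoc, add_comm p.2, hpx]; abel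
      rw [e1] at h1
      refine h1.congr fun t => ?_
      rw [← smul_sub, map_sub]; congr 1; abel
    have h3 := h2.inner (tendsto_const_nhds (x := x - p.1)) (𝕜 := ℝ)
    have h4 : ⟪x - p.1, x - p.1⟫_ℝ ≤ 0 := by
      refine le_of_tendsto h3 (Eventually.of_forall fun t => ?_)
      rw [real_inner_smul_left, inner_sub_left, real_inner_self_eq_norm_sq]
      refine mul_nonpos_of_nonneg_of_nonpos (by positivity) ?_
      have h5 := real_inner_le_norm (hG.semigroup t (x - p.1)) (x - p.1)
      have h6 := mul_le_mul_of_nonneg_right (hG.norm_semigroup_apply_le t (x - p.1))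
        (norm_nonneg (x - p.1))
      linarith
    have h7 : x = p.1 := by
      rw [real_inner_self_eq_norm_sq] at h4
      rw [← sub_eq_zero, ← norm_eq_zero]
      exact pow_eq_zero_iff two_ne_zero |>.1 (le_antisymm h4 (sq_nonneg _))
    have h8 : -z = p.2 := by
      rw [one_smul, ← h7] at hpx
      rw [eq_comm, sub_eq_add_neg] at hpx
      exact add_left_cancel hpx
    rw [h7, h8]; exact hp

end IsNonnegSelfAdjoint

end HilleYosida

/-! ### Differentiation along a contraction semigroup. -/

section SemigroupCalculus

/-- A differential form of Grönwall's inequality, for right derivatives. -/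
theorem le_exp_mul_of_deriv_right_le {v v' : ℝ → ℝ} {l a b : ℝ} (hab : a ≤ b)
    (hc : ContinuousOn v (Icc a b)) (hd : ∀ t ∈ Ico a b, HasDerivWithinAt v (v' t) (Ici t) t)
    (hle : ∀ t ∈ Ico a b, v' t ≤ -l * v t) : v b ≤ Real.exp (-l * (b - a)) * v a := by
  have h1 := image_le_of_deriv_right_le_deriv_boundary
    (f := fun t => Real.exp (l * (t - a)) * v t)
    (f' := fun t => Real.exp (l * (t - a)) * (l * 1) * v t + Real.exp (l * (t - a)) * v' t)
    (B := fun _ => v a) (B' := fun _ => 0) (a := a) (b := b)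
    (ContinuousOn.mul (by fun_prop) hc)
    (fun t ht => by
      refine HasDerivWithinAt.mul ?_ (hd t ht)
      exact ((((hasDerivAt_id t).sub_const a).const_mul l).exp).hasDerivWithinAt)
    (by simp) continuousOn_const (fun t _ => hasDerivWithinAt_const _ _ _)
    (fun t ht => by
      have := mul_nonpos_of_nonneg_of_nonpos (Real.exp_pos (l * (t - a))).le
        (by linarith [hle t ht] : l * v t + v' t ≤ 0)
      linarith) (right_mem_Icc.2 hab)
  have h2 : Real.exp (-l * (b - a)) * Real.exp (l * (b - a)) = 1 := by
    rw [← Real.exp_add]; simp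
  calc v b = Real.exp (-l * (b - a)) * (Real.exp (l * (b - a)) * v b) := by
        rw [← mul_assoc, h2, one_mul]
    _ ≤ _ := mul_le_mul_of_nonneg_left h1 (Real.exp_pos _).le

variable {H : Type*} [NormedAddCommGroup H] [InnerProductSpace ℝ H]
  {P : ℝ≥0 → H →L[ℝ] H}

theorem IsContractionSemigroup.continuous (hP : IsContractionSemigroup P) (x : H) :
    Continuous fun t => P t x := by
  -- Subtraction in `ℝ≥0` is truncated, so this sum is `|p.1 - p.2|`.
  have h0 : Continuous fun p : ℝ≥0 × ℝ≥0 => (p.1 - p.2) + (p.2 - p.1) := by fun_prop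
  have key : ∀ s t : ℝ≥0, ‖P s x - P t x‖ ≤ ‖P ((s - t) + (t - s)) x - x‖ := by
    have : ∀ s t : ℝ≥0, s ≤ t → ‖P s x - P t x‖ ≤ ‖P (t - s) x - x‖ := by
      intro s t hst
      have e : P t x = P s (P (t - s) x) := by
        rw [← hP.add_apply, add_tsub_cancel_of_le hst]
      rw [e, ← map_sub, norm_sub_rev (P (t - s) x)]
      exact hP.norm_apply_le _ _
    intro s t
    rcases le_total s t with h | h
    · simpa [tsub_eq_zero_of_le h] using this s t h
    · rw [norm_sub_rev]
      simpa [tsub_eq_zero_of_le h] using this t s h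
  rw [continuous_iff_continuousAt]
  intro t
  rw [ContinuousAt, tendsto_iff_norm_sub_tendsto_zero]
  refine squeeze_zero (fun _ => norm_nonneg _) (fun s => key s t) ?_
  have h1 : Tendsto (fun s : ℝ≥0 => (s - t) + (t - s)) (𝓝 t) (𝓝 0) := by
    have : Continuous fun s : ℝ≥0 => (s - t) + (t - s) := by fun_prop
    simpa using this.tendsto t
  simpa using (((hP.strongly_continuous x).comp h1).sub_const x).norm

variable {L : H →ₗ.[ℝ] H}

theorem Generates.hasDerivWithinAt (hL : Generates L P) {x y : H} {t : ℝ} (ht : 0 ≤ t)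
    (h : (P t.toNNReal x, y) ∈ L.graph) :
    HasDerivWithinAt (fun s : ℝ => P s.toNNReal x) y (Ici t) t := by
  rw [← hasDerivWithinAt_Ioi_iff_Ici, hasDerivWithinAt_iff_tendsto_slope' self_notMem_Ioi]
  have h1 := (hL.mem_graph_iff _ _).1 h
  have h2 : Tendsto (fun s : ℝ => (s - t).toNNReal) (𝓝[>] t) (𝓝[>] 0) := by
    refine tendsto_nhdsWithin_iff.2 ⟨?_, ?_⟩
    · have : Continuous fun s : ℝ => (s - t).toNNReal := by fun_prop
      refine (this.tendsto' t 0 (by simp)).mono_left nhdsWithin_le_nhds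
    · filter_upwards [self_mem_nhdsWithin] with s hs
      simpa using hs
  refine (h1.comp h2).congr' ?_
  filter_upwards [self_mem_nhdsWithin] with s hs
  have hs' : t < s := hs
  have h3 : s.toNNReal = (s - t).toNNReal + t.toNNReal := by
    rw [← Real.toNNReal_add (by linarith) ht, sub_add_cancel]
  rw [Function.comp_apply, Real.coe_toNNReal _ (by linarith), ← hL.semigroup.add_apply, ← h3,
    slope_def_module]

theorem Generates.mem_graph (hL : Generates L P) {x y : H} (h : (x, y) ∈ L.graph) (t : ℝ≥0) :
    (P t x, P t y) ∈ L.graph := by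
  rw [hL.mem_graph_iff] at h ⊢
  refine (((P t).continuous.tendsto y).comp h).congr fun s => ?_
  rw [Function.comp_apply, map_smul, map_sub, ← hL.semigroup.add_apply, ← hL.semigroup.add_apply,
    add_comm]

theorem Generates.inner_nonpos (hL : Generates L P) {x y : H} (h : (x, y) ∈ L.graph) :
    ⟪y, x⟫_ℝ ≤ 0 := by
  have h3 := ((hL.mem_graph_iff _ _).1 h).inner (tendsto_const_nhds (x := x)) (𝕜 := ℝ)
  refine le_of_tendsto h3 (Eventually.of_forall fun t => ?_)
  rw [real_inner_smul_left, inner_sub_left, real_inner_self_eq_norm_sq]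
  refine mul_nonpos_of_nonneg_of_nonpos (by positivity) ?_
  have h5 := real_inner_le_norm (P t x) x
  have h6 := mul_le_mul_of_nonneg_right (hL.semigroup.norm_apply_le t x) (norm_nonneg x)
  linarith

/-- A contraction semigroup whose adjoint fixes `e` fixes `e`. -/
theorem IsContractionSemigroup.apply_eq_self (hP : IsContractionSemigroup P) {e : H}
    (he : ∀ t x, ⟪e, P t x⟫_ℝ = ⟪e, x⟫_ℝ) (t : ℝ≥0) : P t e = e := by
  rw [← sub_eq_zero, ← norm_eq_zero, ← sq_eq_zero_iff]
  refine le_antisymm ?_ (sq_nonneg _)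
  rw [norm_sub_sq_real, real_inner_comm, he, real_inner_self_eq_norm_sq]
  nlinarith [hP.norm_apply_le t e, norm_nonneg (P t e), norm_nonneg e]

end SemigroupCalculus

/-! ### Graphs of compositions and shifts of unbounded operators. -/

section Graphs

variable {E F G : Type*} [AddCommGroup E] [Module ℝ E] [AddCommGroup F] [Module ℝ F]
  [AddCommGroup G] [Module ℝ G]

theorem mem_graph_val {A : E →ₗ.[ℝ] F} {x : E} (hx : x ∈ A.domain) : (x, val A x) ∈ A.graph := by
  rw [val_of_mem A hx]
  exact A.mem_graph ⟨x, hx⟩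

theorem val_eq_of_mem_graph {A : E →ₗ.[ℝ] F} {x : E} {y : F} (h : (x, y) ∈ A.graph) :
    val A x = y :=
  A.mem_graph_snd_inj (mem_graph_val (LinearPMap.mem_domain_of_mem_graph h)) h rfl

theorem mem_graph_pcomp {B : F →ₗ.[ℝ] G} {A : E →ₗ.[ℝ] F} {x : E} {z : G} :
    (x, z) ∈ (pcomp B A).graph ↔ ∃ y, (x, y) ∈ A.graph ∧ (y, z) ∈ B.graph := by
  constructor
  · intro h
    obtain ⟨⟨x', hx'⟩, h1, h2⟩ := (LinearPMap.mem_graph_iff _).1 h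
    obtain rfl : x' = x := h1
    have hB : A ⟨x', hx'.1⟩ ∈ B.domain := by
      rw [← val_of_mem A hx'.1]
      exact hx'.2
    exact ⟨A ⟨x', hx'.1⟩, A.mem_graph ⟨x', hx'.1⟩,
      (LinearPMap.mem_graph_iff _).2 ⟨⟨_, hB⟩, rfl, h2⟩⟩
  · rintro ⟨y, h1, h2⟩
    have hx := LinearPMap.mem_domain_of_mem_graph h1
    have hy := LinearPMap.mem_domain_of_mem_graph h2
    have hd : x ∈ (pcomp B A).domain := ⟨hx, by rwa [val_eq_of_mem_graph h1]⟩
    have h3 : (pcomp B A) ⟨x, hd⟩ = B ⟨A ⟨x, hx⟩, by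
        rw [← val_of_mem A hx, val_eq_of_mem_graph h1]; exact hy⟩ := rfl
    have h4 : (pcomp B A) ⟨x, hd⟩ = z := by
      rw [h3, ← val_eq_of_mem_graph h2, val_of_mem B hy]
      congr 1
      exact Subtype.ext ((val_of_mem A hx).symm.trans (val_eq_of_mem_graph h1))
    rw [← h4]
    exact (pcomp B A).mem_graph ⟨x, hd⟩

theorem mem_graph_smul_id_add {G : E →ₗ.[ℝ] E} {m : ℝ} {x z : E} :
    (x, z) ∈ ((m • (LinearMap.id : E →ₗ[ℝ] E)).toPMap ⊤ + G).graph ↔ (x, z - m • x) ∈ G.graph := by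
  rw [LinearPMap.mem_graph_iff, LinearPMap.mem_graph_iff]
  constructor
  · rintro ⟨⟨y, hy⟩, rfl, h⟩
    refine ⟨⟨y, hy.2⟩, rfl, ?_⟩
    rw [eq_sub_iff_add_eq']
    exact h
  · rintro ⟨⟨y, hy⟩, rfl, h⟩
    refine ⟨⟨y, ⟨trivial, hy⟩⟩, rfl, ?_⟩
    rw [eq_sub_iff_add_eq'] at h
    exact h

end Graphs

/-! ### Adjoints, closures and von Neumann's theorem. -/

section Adjoint

variable {H : Type*} [NormedAddCommGroup H] [InnerProductSpace ℝ H]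

/-- A closed condition which holds on the graph of an operator holds on the graph of its
closure. -/
theorem closure_graph_induction {T : H →ₗ.[ℝ] H} (hT : T.IsClosable) {p : H × H → Prop}
    (hp : IsClosed {x | p x}) (h : ∀ x ∈ T.graph, p x) : ∀ x ∈ T.closure.graph, p x := by
  intro x hx
  rw [← hT.graph_closure_eq_closure_graph] at hx
  exact closure_minimal (fun x hx => h x hx) hp hx

/-- An operator of dense domain which is the restriction of a bounded operator has that bounded
operator as its closure. -/
theorem val_closure_eq {D : H →ₗ.[ℝ] H} {A : H →L[ℝ] H} (hD : Dense (D.domain : Set H))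
    (hA : ∀ x y, (x, y) ∈ D.graph → y = A x) (x : H) : val D.closure x = A x := by
  have hcl : D.IsClosable := by
    refine ⟨(A : H →ₗ[ℝ] H).toPMap ⊤, le_antisymm ?_ ?_⟩
    · have h0 : IsClosed {p : H × H | p.2 = A p.1} :=
        isClosed_eq continuous_snd (A.continuous.comp continuous_fst)
      intro p hp
      have h1 : p.2 = A p.1 := closure_minimal (fun q hq => hA q.1 q.2 hq) h0 hp
      exact (LinearPMap.mem_graph_iff _).2 ⟨⟨p.1, trivial⟩, rfl, h1.symm⟩
    · intro p hp
      obtain ⟨y, h1, h2⟩ := (LinearPMap.mem_graph_iff _).1 hp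
      have h3 : p = (fun x => (x, A x)) p.1 := by
        refine Prod.ext rfl ?_
        rw [← h2, ← h1]; rfl
      have hc : Continuous fun x => (x, A x) := by fun_prop
      rw [h3]
      refine closure_mono ?_ (image_closure_subset_closure_image hc ⟨p.1, hD p.1, rfl⟩)
      rintro _ ⟨z, hz, rfl⟩
      have := mem_graph_val hz
      rwa [hA _ _ this] at this
  have hc : Continuous fun x => (x, A x) := by fun_prop
  refine val_eq_of_mem_graph ?_
  rw [← hcl.graph_closure_eq_closure_graph]
  refine closure_mono ?_ (image_closure_subset_closure_image hc ⟨x, hD x, rfl⟩)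
  rintro _ ⟨z, hz, rfl⟩
  have := mem_graph_val hz
  rwa [hA _ _ this] at this

variable [CompleteSpace H]

theorem mem_graph_adjoint {T : H →ₗ.[ℝ] H} (hT : Dense (T.domain : Set H)) {y z : H} :
    (y, z) ∈ T†.graph ↔ ∀ p ∈ T.graph, ⟪p.2, y⟫_ℝ = ⟪p.1, z⟫_ℝ := by
  rw [LinearPMap.adjoint_graph_eq_graph_adjoint hT, Submodule.mem_adjoint_iff]
  simp only [sub_eq_zero, Prod.forall]

theorem inner_adjoint_closure {T : H →ₗ.[ℝ] H} (hT : Dense (T.domain : Set H))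
    (hcl : T.IsClosable) {p q : H × H} (hp : p ∈ T.closure.graph) (hq : q ∈ T†.graph) :
    ⟪p.2, q.1⟫_ℝ = ⟪p.1, q.2⟫_ℝ :=
  closure_graph_induction hcl (p := fun p => ⟪p.2, q.1⟫_ℝ = ⟪p.1, q.2⟫_ℝ)
    (isClosed_eq (by fun_prop) (by fun_prop)) ((mem_graph_adjoint hT).1 hq) p hp

/-- The variational problem behind von Neumann's theorem on `T* T`. -/
theorem exists_graph_variational {S : Submodule ℝ (H × H)} (hS : IsClosed (S : Set (H × H)))
    {l : ℝ} (hl : 0 < l) (h : H) :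
    ∃ p ∈ S, ∀ q ∈ S, l * ⟪p.1, q.1⟫_ℝ + ⟪p.2, q.2⟫_ℝ = ⟪h, q.1⟫_ℝ := by
  -- Rescaling the first coordinate by `√l` turns `l ⟪·, ·⟫ + ⟪·, ·⟫` into the inner product of the
  -- ℓ² product. The solution is the orthogonal projection of `(h / √l, 0)` onto the rescaled closed
  -- subspace.
  set r := √l with hr
  have hr0 : 0 < r := Real.sqrt_pos.2 hl
  have hrr : r * r = l := Real.mul_self_sqrt hl.le
  let e := WithLp.prodContinuousLinearEquiv 2 ℝ H H
  let φ : WithLp 2 (H × H) →L[ℝ] H × H :=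
    ((r⁻¹ • ContinuousLinearMap.id ℝ H).prodMap (ContinuousLinearMap.id ℝ H)).comp
      (e : WithLp 2 (H × H) →L[ℝ] H × H)
  let S' : Submodule ℝ (WithLp 2 (H × H)) := S.comap (φ : WithLp 2 (H × H) →ₗ[ℝ] H × H)
  have hS' : IsClosed (S' : Set (WithLp 2 (H × H))) := hS.preimage φ.continuous
  have : CompleteSpace S' := hS'.completeSpace_coe
  set w : WithLp 2 (H × H) := WithLp.toLp 2 (r⁻¹ • h, 0) with hw
  set g : WithLp 2 (H × H) := S'.starProjection w with hg
  have hgS : g ∈ S' := Submodule.starProjection_apply_mem _ _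
  refine ⟨φ g, hgS, fun q hq => ?_⟩
  have h1 : WithLp.toLp 2 (r • q.1, q.2) ∈ S' := by
    change (r⁻¹ • r • q.1, q.2) ∈ S
    rwa [smul_smul, inv_mul_cancel₀ hr0.ne', one_smul]
  have h2 := Submodule.starProjection_inner_eq_zero (K := S') w _ h1
  rw [← hg, WithLp.prod_inner_apply] at h2
  simp only [hw, WithLp.ofLp_sub, Prod.fst_sub, Prod.snd_sub, inner_sub_left,
    real_inner_smul_left, real_inner_smul_right, inner_zero_left] at h2
  have e1 : (φ g).1 = r⁻¹ • (WithLp.ofLp g).1 := rfl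
  have e2 : (φ g).2 = (WithLp.ofLp g).2 := rfl
  rw [e1, e2, real_inner_smul_left, ← hrr]
  have e3 : r⁻¹ * r = 1 := inv_mul_cancel₀ hr0.ne'
  linear_combination -h2 + r * ⟪(WithLp.ofLp g).1, q.1⟫_ℝ * e3
    + ⟪h, q.1⟫_ℝ * e3

/-- **von Neumann**: `T* T̄` is nonnegative and self-adjoint. -/
theorem isNonnegSelfAdjoint_pcomp {T : H →ₗ.[ℝ] H} (hT : Dense (T.domain : Set H))
    (hcl : T.IsClosable) : IsNonnegSelfAdjoint (pcomp T† T.closure) where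
  nonneg p hp := by
    obtain ⟨y, h1, h2⟩ := mem_graph_pcomp.1 hp
    have := inner_adjoint_closure hT hcl h1 h2
    rw [real_inner_comm, ← this]
    exact real_inner_self_nonneg
  symm p hp q hq := by
    obtain ⟨y, h1, h2⟩ := mem_graph_pcomp.1 hp
    obtain ⟨z, h3, h4⟩ := mem_graph_pcomp.1 hq
    rw [← inner_adjoint_closure hT hcl h1 h4, real_inner_comm,
      ← inner_adjoint_closure hT hcl h3 h2, real_inner_comm]
  surj l hl h := by
    -- Tested on the graph of T, the variational equation says that `p.2` lies in the domain of `T†`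
    -- with `T† p.2 = h - l p.1`.
    obtain ⟨p, hp, hq⟩ := exists_graph_variational hcl.closure_isClosed hl h
    refine ⟨(p.1, h - l • p.1), mem_graph_pcomp.2 ⟨p.2, hp, (mem_graph_adjoint hT).2 ?_⟩, by simp⟩
    intro q hqT
    have := hq q (LinearPMap.le_graph_of_le T.le_closure hqT)
    rw [inner_sub_right, real_inner_smul_right, real_inner_comm, real_inner_comm h,
      real_inner_comm p.1]
    linarith

end Adjoint

/-! ### Boundedness of the operator 𝒜 and its algebra. -/

section BoundedParts

variable {H : Type*} [NormedAddCommGroup H] [InnerProductSpace ℝ H] [CompleteSpace H]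
  {T : H →ₗ.[ℝ] H} (hT : Dense (T.domain : Set H)) (hcl : T.IsClosable) {m : ℝ} (hm : 0 < m)

/-- The bounded operator `(m + T* T̄)⁻¹`. -/
def resolventOp : H →L[ℝ] H := (isNonnegSelfAdjoint_pcomp hT hcl).resolvent hm

theorem exists_closure_comp_resolventOp :
    ∃ W : H →L[ℝ] H, ∀ h, (resolventOp hT hcl hm h, W h) ∈ T.closure.graph ∧
      (W h, h - m • resolventOp hT hcl hm h) ∈ T†.graph := by
  choose w hw hw' using fun h =>
    mem_graph_pcomp.1 ((isNonnegSelfAdjoint_pcomp hT hcl).resolvent_mem_graph hm h)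
  have hsub : ∀ {x y z : H}, (x, y) ∈ T.closure.graph → (x, z) ∈ T.closure.graph → y = z :=
    fun h1 h2 => T.closure.mem_graph_snd_inj h1 h2 rfl
  refine ⟨LinearMap.mkContinuous
    { toFun := w
      map_add' := fun h k => hsub (hw _) ?_
      map_smul' := fun c h => hsub (hw _) ?_ } (√m)⁻¹ ?_, fun h => ⟨hw h, hw' h⟩⟩
  · have := T.closure.graph.add_mem (hw h) (hw k)
    rwa [map_add]
  · have := T.closure.graph.smul_mem c (hw h)
    rwa [map_smul]
  · intro h
    have h1 := inner_adjoint_closure hT hcl (hw h) (hw' h)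
    have h2 := (isNonnegSelfAdjoint_pcomp hT hcl).mul_norm_resolvent_le hm h
    set g := (isNonnegSelfAdjoint_pcomp hT hcl).resolvent hm h
    simp only [inner_sub_right, real_inner_smul_right, real_inner_self_eq_norm_sq] at h1
    have h3 := real_inner_le_norm g h
    change ‖w h‖ ≤ _
    rw [inv_mul_eq_div, le_div_iff₀ (Real.sqrt_pos.2 hm)]
    refine le_of_sq_le_sq ?_ (norm_nonneg _)
    rw [mul_pow, Real.sq_sqrt hm.le, h1]
    have h4 := mul_le_mul_of_nonneg_right h2 (norm_nonneg h)
    nlinarith [mul_nonneg hm.le (mul_nonneg hm.le (sq_nonneg ‖g‖))]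

/-- The bounded operator `T̄ (m + T* T̄)⁻¹`. -/
def closureResolventOp : H →L[ℝ] H := (exists_closure_comp_resolventOp hT hcl hm).choose

theorem mem_closure_graph_resolventOp (h : H) :
    (resolventOp hT hcl hm h, closureResolventOp hT hcl hm h) ∈ T.closure.graph :=
  ((exists_closure_comp_resolventOp hT hcl hm).choose_spec h).1

theorem mem_adjoint_graph_resolventOp (h : H) :
    (closureResolventOp hT hcl hm h, h - m • resolventOp hT hcl hm h) ∈ T†.graph :=
  ((exists_closure_comp_resolventOp hT hcl hm).choose_spec h).2

/-- The bounded extension of `(m + T* T̄)⁻¹ (-T)*`. -/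
def boundedA : H →L[ℝ] H := -ContinuousLinearMap.adjoint (closureResolventOp hT hcl hm)

theorem inner_boundedA (f h : H) :
    ⟪boundedA hT hcl hm f, h⟫_ℝ = -⟪f, closureResolventOp hT hcl hm h⟫_ℝ := by
  rw [boundedA, neg_apply, inner_neg_left, ContinuousLinearMap.adjoint_inner_left]

theorem inner_resolventOp_left (h k : H) :
    ⟪resolventOp hT hcl hm h, k⟫_ℝ = ⟪h, resolventOp hT hcl hm k⟫_ℝ :=
  (isNonnegSelfAdjoint_pcomp hT hcl).inner_resolvent_left hm h k

/-- The energy identity: the equation `(m + T* T̄) g = h` tested against `g`. -/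
theorem norm_sq_resolventOp (h : H) :
    m * ‖resolventOp hT hcl hm h‖ ^ 2 + ‖closureResolventOp hT hcl hm h‖ ^ 2
      = ⟪h, resolventOp hT hcl hm h⟫_ℝ := by
  have h1 := inner_adjoint_closure hT hcl (mem_closure_graph_resolventOp hT hcl hm h)
    (mem_adjoint_graph_resolventOp hT hcl hm h)
  simp only [inner_sub_right, real_inner_smul_right, real_inner_self_eq_norm_sq] at h1
  rw [real_inner_comm]
  linarith

theorem norm_closureResolventOp_le (h : H) :
    ‖closureResolventOp hT hcl hm h‖ ≤ 1 / (2 * √m) * ‖h‖ := by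
  have h1 := norm_sq_resolventOp hT hcl hm h
  have h2 := real_inner_le_norm h (resolventOp hT hcl hm h)
  have h0 := Real.sqrt_pos.2 hm
  rw [one_div, inv_mul_eq_div, le_div_iff₀ (by positivity)]
  refine le_of_sq_le_sq ?_ (norm_nonneg _)
  rw [mul_pow, mul_pow, Real.sq_sqrt hm.le]
  -- Completing the square in `‖h‖ ‖g‖ - m ‖g‖²`, whose maximum over `‖g‖` is `‖h‖² / (4m)`.
  nlinarith [sq_nonneg (‖h‖ - 2 * m * ‖resolventOp hT hcl hm h‖)]

theorem boundedA_apply_of_mem_adjoint {x z : H} (h : (x, z) ∈ T†.graph) :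
    boundedA hT hcl hm x = -resolventOp hT hcl hm z := by
  refine ext_inner_right ℝ fun k => ?_
  have h1 := inner_adjoint_closure hT hcl (mem_closure_graph_resolventOp hT hcl hm k) h
  rw [inner_boundedA, inner_neg_left, inner_resolventOp_left, real_inner_comm, h1,
    real_inner_comm]

/-- This is the identity `𝒜 T̄ = -T* T̄ (m + T* T̄)⁻¹` that makes the entropy correction
dissipative. -/
theorem boundedA_apply_of_mem_closure {x y : H} (h : (x, y) ∈ T.closure.graph) :
    boundedA hT hcl hm y = -(x - m • resolventOp hT hcl hm x) := by
  refine ext_inner_right ℝ fun k => ?_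
  have h1 := inner_adjoint_closure hT hcl h (mem_adjoint_graph_resolventOp hT hcl hm k)
  simp only at h1
  rw [inner_boundedA, h1, inner_neg_left, inner_sub_left, inner_sub_right, real_inner_smul_left,
    real_inner_smul_right, inner_resolventOp_left]

/-- Since `m + T* T̄` is onto, 𝒜 is defined on all of the dense domain of `T†`, and there it
coincides with the bounded operator `-(T̄ (m + T* T̄)⁻¹)*`. -/
theorem val_closure_eq_boundedA (hT' : Dense (T†.domain : Set H)) (x : H) :
    val (pcomp ((m • (LinearMap.id : H →ₗ[ℝ] H)).toPMap ⊤ + pcomp T† T.closure).inverse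
      (-T)†).closure x = boundedA hT hcl hm x := by
  have hG := isNonnegSelfAdjoint_pcomp hT hcl
  set M := (m • (LinearMap.id : H →ₗ[ℝ] H)).toPMap ⊤ + pcomp T† T.closure with hMdef
  have hM : ∀ {u v : H}, (u, v) ∈ M.graph ↔ (u, v - m • u) ∈ (pcomp T† T.closure).graph :=
    mem_graph_smul_id_add
  have hneg : ∀ {u v : H}, (u, v) ∈ (-T)†.graph ↔ (u, -v) ∈ T†.graph := by
    intro u v
    rw [mem_graph_adjoint (T := -T) hT, mem_graph_adjoint hT]
    constructor
    · rintro h ⟨a, b⟩ hp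
      have := h (a, -b) (mem_graph_neg.2 (by simpa using hp))
      simp only [inner_neg_left, inner_neg_right] at this ⊢
      linarith
    · rintro h ⟨a, b⟩ hp
      have := h (a, -b) (mem_graph_neg.1 hp)
      simp only [inner_neg_left, inner_neg_right] at this ⊢
      linarith
  have hres : ∀ {u v : H}, (u, v) ∈ M.graph → u = resolventOp hT hcl hm v := by
    intro u v h
    have := hG.resolvent_add hm (hM.1 h)
    rw [add_sub_cancel] at this
    exact this.symm
  have hker : LinearMap.ker M.toFun = ⊥ := by
    rw [LinearMap.ker_eq_bot']
    rintro ⟨u, hu⟩ h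
    have h1 : (u, (0 : H)) ∈ M.graph := by
      rw [← h]; exact M.mem_graph ⟨u, hu⟩
    exact Subtype.ext (by simpa using hres h1)
  have hinv : ∀ {u v : H}, (v, u) ∈ M.inverse.graph ↔ (u, v) ∈ M.graph := by
    intro u v
    rw [LinearPMap.inverse_graph hker, Submodule.mem_map]
    constructor
    · rintro ⟨⟨a, b⟩, h1, h2⟩
      obtain ⟨rfl, rfl⟩ := Prod.ext_iff.1 h2
      exact h1
    · exact fun h => ⟨_, h, rfl⟩
  refine val_closure_eq ?_ ?_ x
  · refine hT'.mono fun y hy => ?_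
    obtain ⟨z, hz⟩ := LinearPMap.mem_domain_iff.1 hy
    refine LinearPMap.mem_domain_of_mem_graph (mem_graph_pcomp.2 ⟨-z, hneg.2 (by simpa using hz),
      hinv.2 (hM.2 (hG.resolvent_mem_graph hm _))⟩)
  · intro y u h
    obtain ⟨z, h1, h2⟩ := mem_graph_pcomp.1 h
    rw [boundedA_apply_of_mem_adjoint hT hcl hm (hneg.1 h1), map_neg, neg_neg]
    exact hres (hinv.1 h2)

end BoundedParts

/-! ### The abstract setting: structure of 𝒯Π and the two bounds on 𝒜. -/

section Setting

variable {H : Type*} [NormedAddCommGroup H] [InnerProductSpace ℝ H] [CompleteSpace H]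

/-- The hypotheses on the operators, in an abstract Hilbert space: `Pv` is an orthogonal projection
and `e` is a unit vector, which plays the role of the constant function `1`. -/
structure OperatorSetting (L : H →ₗ.[ℝ] H) (P : ℝ≥0 → H →L[ℝ] H) (C : Submodule ℝ H)
    (Pv : H →L[ℝ] H) (e : H) (m R₀ : ℝ) : Prop where
  isClosed : L.IsClosed
  generates : Generates L P
  core : L.HasCore C
  dense : Dense (C : Set H)
  le_adjoint_domain : C ≤ L†.domain
  stable : ∀ f ∈ C, Pv f ∈ C
  symm : ∀ x y, ⟪Pv x, y⟫_ℝ = ⟪x, Pv y⟫_ℝ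
  idem : ∀ x, Pv (Pv x) = Pv x
  range_le_ker : ∀ f, ∃ h : Pv f ∈ (symPart L C)†.domain, (symPart L C)† ⟨Pv f, h⟩ = 0
  proj_T_proj : ∀ f ∈ C, Pv (val (antisymPart L C) (Pv f)) = 0
  norm_e : ‖e‖ = 1
  proj_e : Pv e = e
  inner_e : ∀ t x, ⟪e, P t x⟫_ℝ = ⟪e, x⟫_ℝ
  pos : 0 < m
  remainder : ∀ f ∈ C, |⟪val (opA m L C Pv).closure (val (antisymPart L C) (f - Pv f)), f⟫_ℝ
      + ⟪val (opA m L C Pv).closure (val (symPart L C) f), f⟫_ℝ| ≤ R₀ * ‖f - Pv f‖ * ‖Pv f‖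

theorem mem_domain_symPart {L : H →ₗ.[ℝ] H} {C : Submodule ℝ H} {f : H} (hf : f ∈ C)
    (h1 : f ∈ L.domain) (h2 : f ∈ L†.domain) : f ∈ (symPart L C).domain :=
  ⟨hf, h1, h2⟩

theorem val_symPart {L : H →ₗ.[ℝ] H} {C : Submodule ℝ H} {f : H} (hf : f ∈ C) (h1 : f ∈ L.domain)
    (h2 : f ∈ L†.domain) : val (symPart L C) f = (1 / 2 : ℝ) • (val L f + val L† f) := by
  rw [val_of_mem _ (mem_domain_symPart hf h1 h2), val_of_mem _ h1, val_of_mem _ h2]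
  rfl

theorem val_antisymPart {L : H →ₗ.[ℝ] H} {C : Submodule ℝ H} {f : H} (hf : f ∈ C)
    (h1 : f ∈ L.domain) (h2 : f ∈ L†.domain) :
    val (antisymPart L C) f = (1 / 2 : ℝ) • (val L f - val L† f) := by
  have h : f ∈ (antisymPart L C).domain := ⟨hf, h1, h2⟩
  rw [val_of_mem _ h, val_of_mem _ h1, val_of_mem _ h2]
  rfl

namespace OperatorSetting

variable {L : H →ₗ.[ℝ] H} {P : ℝ≥0 → H →L[ℝ] H} {C : Submodule ℝ H} {Pv : H →L[ℝ] H} {e : H}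
  {m R₀ : ℝ} (hs : OperatorSetting L P C Pv e m R₀)

include hs

theorem mem_domain {f : H} (hf : f ∈ C) : f ∈ L.domain := hs.core.le_domain hf

theorem dense_domain : Dense (L.domain : Set H) := hs.dense.mono hs.core.le_domain

theorem sym_apply {f : H} (hf : f ∈ C) :
    val (symPart L C) f = (1 / 2 : ℝ) • (val L f + val L† f) :=
  val_symPart hf (hs.mem_domain hf) (hs.le_adjoint_domain hf)

theorem antisym_apply {f : H} (hf : f ∈ C) :
    val (antisymPart L C) f = (1 / 2 : ℝ) • (val L f - val L† f) :=
  val_antisymPart hf (hs.mem_domain hf) (hs.le_adjoint_domain hf)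

theorem inner_adjoint {f g h : H} (hf : f ∈ C) (hg : (g, h) ∈ L.graph) :
    ⟪h, f⟫_ℝ = ⟪g, val L† f⟫_ℝ :=
  (mem_graph_adjoint hs.dense_domain).1 (mem_graph_val (hs.le_adjoint_domain hf)) _ hg

theorem inner_sym {f g : H} (hf : f ∈ C) (hg : g ∈ C) :
    ⟪val (symPart L C) f, g⟫_ℝ = ⟪f, val (symPart L C) g⟫_ℝ := by
  have h1 := hs.inner_adjoint hg (mem_graph_val (hs.mem_domain hf))
  have h2 := hs.inner_adjoint hf (mem_graph_val (hs.mem_domain hg))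
  rw [real_inner_comm, real_inner_comm (val L† f)] at h2
  rw [hs.sym_apply hf, hs.sym_apply hg, real_inner_smul_left, real_inner_smul_right,
    inner_add_left, inner_add_right, h1, h2]
  ring

theorem inner_antisym {f g : H} (hf : f ∈ C) (hg : g ∈ C) :
    ⟪val (antisymPart L C) f, g⟫_ℝ = -⟪f, val (antisymPart L C) g⟫_ℝ := by
  have h1 := hs.inner_adjoint hg (mem_graph_val (hs.mem_domain hf))
  have h2 := hs.inner_adjoint hf (mem_graph_val (hs.mem_domain hg))
  rw [real_inner_comm, real_inner_comm (val L† f)] at h2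
  rw [hs.antisym_apply hf, hs.antisym_apply hg, real_inner_smul_left, real_inner_smul_right,
    inner_sub_left, inner_sub_right, h1, h2]
  ring

/-- 𝒮 is symmetric on the dense set `C`, so a vector of `C` that `𝒮*` kills is killed by 𝒮. -/
theorem sym_proj {f : H} (hf : Pv f ∈ C) : val (symPart L C) (Pv f) = 0 := by
  have hd : (C : Set H) ⊆ (symPart L C).domain := fun g hg =>
    mem_domain_symPart hg (hs.mem_domain hg) (hs.le_adjoint_domain hg)
  obtain ⟨h1, h2⟩ := hs.range_le_ker f
  refine hs.dense.eq_zero_of_inner_left ℝ fun g hg => ?_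
  have h3 := (mem_graph_adjoint (hs.dense.mono hd)).1 ((symPart L C)†.mem_graph ⟨_, h1⟩)
    _ (mem_graph_val (hd hg))
  rw [h2] at h3
  rw [hs.inner_sym hf hg, real_inner_comm]
  simpa using h3

theorem val_proj {f : H} (hf : Pv f ∈ C) : val L (Pv f) = val (antisymPart L C) (Pv f) ∧
    val L† (Pv f) = -val (antisymPart L C) (Pv f) := by
  have h1 := hs.sym_proj hf
  rw [hs.sym_apply hf, smul_eq_zero_iff_right (by norm_num), add_eq_zero_iff_eq_neg] at h1
  rw [hs.antisym_apply hf, h1, ← neg_add', ← two_smul ℝ, smul_neg, smul_smul]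
  simp

omit hs in
theorem mem_graph_TPi {x y : H} :
    (x, y) ∈ (TPi L C Pv).graph ↔ (Pv x, y) ∈ (antisymPart L C).graph := by
  rw [TPi, mem_graph_pcomp]
  constructor
  · rintro ⟨z, h1, h2⟩
    obtain ⟨⟨w, hw⟩, rfl, h3⟩ := (LinearPMap.mem_graph_iff _).1 h1
    have : z = Pv w := h3.symm
    rwa [← this]
  · exact fun h => ⟨Pv x, (LinearPMap.mem_graph_iff _).2 ⟨⟨x, trivial⟩, rfl, rfl⟩, h⟩

theorem of_mem_graph_TPi {x y : H} (h : (x, y) ∈ (TPi L C Pv).graph) :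
    Pv x ∈ C ∧ val L (Pv x) = y ∧ val L† (Pv x) = -y ∧ Pv y = 0 := by
  rw [mem_graph_TPi] at h
  have h1 : Pv x ∈ C := (LinearPMap.mem_domain_of_mem_graph h).1
  have h2 := val_eq_of_mem_graph h
  have h3 := hs.val_proj h1
  have h4 := hs.proj_T_proj _ h1
  rw [h2] at h3
  rw [hs.idem, h2] at h4
  exact ⟨h1, h3.1, h3.2, h4⟩

theorem mem_graph_TPi_of_mem {x : H} (h : Pv x ∈ C) :
    (x, val (antisymPart L C) (Pv x)) ∈ (TPi L C Pv).graph :=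
  mem_graph_TPi.2 (mem_graph_val ⟨h, hs.mem_domain h, hs.le_adjoint_domain h⟩)

theorem dense_TPi : Dense ((TPi L C Pv).domain : Set H) :=
  hs.dense.mono fun f hf =>
    LinearPMap.mem_domain_of_mem_graph (hs.mem_graph_TPi_of_mem (hs.stable f hf))

/-- Since 𝒮Π = 0, the operator 𝒯Π agrees with ℒΠ on its domain, and ℒ is closed. -/
theorem isClosable_TPi : (TPi L C Pv).IsClosable := by
  refine ⟨_, (Submodule.toLinearPMap_graph_eq (TPi L C Pv).graph.topologicalClosure ?_).symm⟩
  rintro ⟨x, y⟩ hx rfl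
  have h1 : ((TPi L C Pv).graph : Set (H × H)) ⊆ {p | (Pv p.1, p.2) ∈ L.graph} := by
    rintro ⟨a, b⟩ hab
    obtain ⟨h1, h2, -, -⟩ := hs.of_mem_graph_TPi hab
    have := mem_graph_val (hs.mem_domain h1)
    rwa [h2] at this
  have hc : Continuous fun p : H × H => (Pv p.1, p.2) := by fun_prop
  have h2 := closure_minimal h1 (hs.isClosed.preimage hc) hx
  simp only [mem_ofPred_eq, map_zero] at h2
  exact L.graph_fst_eq_zero_snd h2 rfl

/-- The closed forms of Π𝒯Π = 0 and ℒ*Π = -𝒯Π; the second is tested against the graph of ℒ. -/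
theorem of_mem_closure_TPi {p : H × H} (hp : p ∈ (TPi L C Pv).closure.graph) :
    Pv p.2 = 0 ∧ ∀ q ∈ L.graph, ⟪q.2, Pv p.1⟫_ℝ = -⟪q.1, p.2⟫_ℝ := by
  refine ⟨closure_graph_induction hs.isClosable_TPi (p := fun p => Pv p.2 = 0)
    (isClosed_eq (by fun_prop) (by fun_prop)) (fun p h => (hs.of_mem_graph_TPi h).2.2.2) p hp,
    fun q hq => closure_graph_induction hs.isClosable_TPi
      (p := fun p => ⟪q.2, Pv p.1⟫_ℝ = -⟪q.1, p.2⟫_ℝ)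
      (isClosed_eq (by fun_prop) (by fun_prop)) (fun p h => ?_) p hp⟩
  obtain ⟨h1, -, h3, -⟩ := hs.of_mem_graph_TPi h
  rw [hs.inner_adjoint h1 hq, h3, inner_neg_right]

theorem mem_adjoint_TPi {f : H} (hf : f ∈ C) :
    (f, -Pv (val (antisymPart L C) f)) ∈ (TPi L C Pv)†.graph := by
  rw [mem_graph_adjoint hs.dense_TPi]
  intro p hp
  have h1 := val_eq_of_mem_graph (mem_graph_TPi.1 hp)
  rw [← h1, hs.inner_antisym (hs.of_mem_graph_TPi hp).1 hf, inner_neg_right, hs.symm]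

theorem dense_adjoint_TPi : Dense ((TPi L C Pv)†.domain : Set H) :=
  hs.dense.mono fun _ hf => LinearPMap.mem_domain_of_mem_graph (hs.mem_adjoint_TPi hf)

/-- 𝒯Π vanishes on the kernel of Π, so the range of its adjoint is orthogonal to that kernel. -/
theorem proj_of_mem_adjoint {y z : H} (h : (y, z) ∈ (TPi L C Pv)†.graph) : Pv z = z := by
  have h1 : Pv (z - Pv z) = 0 := by rw [map_sub, hs.idem, sub_self]
  have h2 := (mem_graph_adjoint hs.dense_TPi).1 h (z - Pv z, 0) (by
    rw [mem_graph_TPi, h1]; exact Submodule.zero_mem _)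
  simp only [inner_zero_left] at h2
  have h3 : ⟪z - Pv z, Pv z⟫_ℝ = 0 := by rw [← hs.symm, h1, inner_zero_left]
  have h4 : ⟪z - Pv z, z - Pv z⟫_ℝ = 0 := by rw [inner_sub_right, ← h2, h3, sub_zero]
  exact (sub_eq_zero.1 (inner_self_eq_zero.1 h4)).symm

theorem isNonnegSelfAdjoint : IsNonnegSelfAdjoint (opG L C Pv) :=
  isNonnegSelfAdjoint_pcomp hs.dense_TPi hs.isClosable_TPi

/-- `(m + G)⁻¹`. -/
def res : H →L[ℝ] H := resolventOp hs.dense_TPi hs.isClosable_TPi hs.pos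

/-- The closure of `𝒯 Π` applied to `(m + G)⁻¹`. -/
def clRes : H →L[ℝ] H := closureResolventOp hs.dense_TPi hs.isClosable_TPi hs.pos

/-- The closure of `𝒜`. -/
def A : H →L[ℝ] H := boundedA hs.dense_TPi hs.isClosable_TPi hs.pos

/-- `G (m + G)⁻¹`. -/
def K : H →L[ℝ] H := 1 - m • hs.res

theorem K_apply (f : H) : hs.K f = f - m • hs.res f := rfl

theorem val_opA (f : H) : val (opA m L C Pv).closure f = hs.A f :=
  val_closure_eq_boundedA hs.dense_TPi hs.isClosable_TPi hs.pos hs.dense_adjoint_TPi f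

theorem mem_closure_res (h : H) : (hs.res h, hs.clRes h) ∈ (TPi L C Pv).closure.graph :=
  mem_closure_graph_resolventOp _ _ _ h

theorem mem_adjoint_res (h : H) : (hs.clRes h, hs.K h) ∈ (TPi L C Pv)†.graph :=
  mem_adjoint_graph_resolventOp _ _ _ h

theorem inner_A (f h : H) : ⟪hs.A f, h⟫_ℝ = -⟪f, hs.clRes h⟫_ℝ := inner_boundedA _ _ _ f h

theorem inner_res_left (f h : H) : ⟪hs.res f, h⟫_ℝ = ⟪f, hs.res h⟫_ℝ :=
  inner_resolventOp_left _ _ _ f h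

theorem inner_K_left (f h : H) : ⟪hs.K f, h⟫_ℝ = ⟪f, hs.K h⟫_ℝ := by
  simp only [K_apply, inner_sub_left, inner_sub_right, real_inner_smul_left,
    real_inner_smul_right, hs.inner_res_left]

theorem proj_K (f : H) : Pv (hs.K f) = hs.K f := hs.proj_of_mem_adjoint (hs.mem_adjoint_res f)

theorem proj_clRes (f : H) : Pv (hs.clRes f) = 0 := (hs.of_mem_closure_TPi (hs.mem_closure_res f)).1

theorem inner_eq_inner_sub {f w : H} (hw : Pv w = 0) : ⟪f, w⟫_ℝ = ⟪f - Pv f, w⟫_ℝ := by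
  rw [inner_sub_left, hs.symm, hw, inner_zero_right, sub_zero]

theorem proj_res {f : H} (hf : Pv f = f) : Pv (hs.res f) = hs.res f := by
  have h1 := hs.proj_K f
  rw [K_apply, map_sub, hf, map_smul] at h1
  exact smul_right_injective H hs.pos.ne' (sub_right_injective h1)

theorem A_apply {f : H} (hf : f ∈ C) :
    hs.A f = hs.res (Pv (val (antisymPart L C) f)) := by
  refine (boundedA_apply_of_mem_adjoint _ _ _ (hs.mem_adjoint_TPi hf)).trans ?_
  rw [map_neg, neg_neg]; rfl

theorem proj_A (f : H) : Pv (hs.A f) = hs.A f := by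
  have h : IsClosed {f | Pv (hs.A f) = hs.A f} := isClosed_eq (by fun_prop) (by fun_prop)
  refine closure_minimal (fun f hf => ?_) h (hs.dense f)
  change Pv (hs.A f) = hs.A f
  rw [hs.A_apply hf]
  exact hs.proj_res (hs.idem _)

/-- The range of 𝒜 lies in that of Π, and Π𝒯Π = 0 makes 𝒜 depend on `f - Πf` only. The factor `1 /
(2 √m)` is the norm bound of `closureResolventOp`. -/
theorem abs_inner_A_le (f h : H) :
    |⟪hs.A f, h⟫_ℝ| ≤ 1 / (2 * √m) * (‖f - Pv f‖ * ‖Pv h‖) := by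
  have h1 : ⟪hs.A f, h⟫_ℝ = -⟪f - Pv f, hs.clRes (Pv h)⟫_ℝ := by
    rw [← hs.proj_A, hs.symm, hs.inner_A, hs.inner_eq_inner_sub (hs.proj_clRes _)]
  rw [h1, abs_neg]
  refine (abs_real_inner_le_norm _ _).trans ?_
  have := norm_closureResolventOp_le hs.dense_TPi hs.isClosable_TPi hs.pos (Pv h)
  calc _ ≤ ‖f - Pv f‖ * (1 / (2 * √m) * ‖Pv h‖) := by gcongr; exact this
    _ = _ := by ring

/-- A closed condition which holds on the core holds on the graph of `L`. -/
theorem core_induction {p : H × H → Prop} (hp : IsClosed {x | p x})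
    (h : ∀ f ∈ C, p (f, val L f)) : ∀ q ∈ L.graph, p q := by
  have hle : L.domRestrict C ≤ L := LinearPMap.domRestrict_le
  have h1 : (L.domRestrict C).IsClosable := hs.isClosed.isClosable.leIsClosable hle
  have h2 := closure_graph_induction h1 hp fun q hq => by
    have h3 := LinearPMap.le_graph_of_le hle hq
    have h4 := h q.1 (LinearPMap.mem_domain_of_mem_graph hq).1
    rwa [val_eq_of_mem_graph h3] at h4
  rwa [hs.core.closure_eq] at h2

theorem remainder_le : ∀ q ∈ L.graph,
    |⟪hs.A q.2, q.1⟫_ℝ + ⟪hs.K q.1, q.1⟫_ℝ| ≤ R₀ * ‖q.1 - Pv q.1‖ * ‖Pv q.1‖ := by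
  refine hs.core_induction (isClosed_le (by fun_prop) (by fun_prop)) fun f hf => ?_
  have hPf := hs.stable f hf
  have h1 := hs.remainder f hf
  rw [hs.val_opA, hs.val_opA, ← inner_add_left, ← map_add] at h1
  -- The two operators of the remainder condition add up to `ℒf - 𝒯Πf`, and 𝒜 sends `-𝒯Πf` to `Kf`.
  have h2 : val (antisymPart L C) (f - Pv f) + val (symPart L C) f
      = val L f - val (antisymPart L C) (Pv f) := by
    have hT : val (antisymPart L C) (f - Pv f)
        = val (antisymPart L C) f - val (antisymPart L C) (Pv f) := by
      have hd : ∀ g ∈ C, g ∈ (antisymPart L C).domain := fun g hg =>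
        ⟨hg, hs.mem_domain hg, hs.le_adjoint_domain hg⟩
      exact val_eq_of_mem_graph ((antisymPart L C).graph.sub_mem (mem_graph_val (hd f hf))
        (mem_graph_val (hd _ hPf)))
    have h3 : val (antisymPart L C) f + val (symPart L C) f = val L f := by
      rw [hs.antisym_apply hf, hs.sym_apply hf, ← smul_add, sub_add_add_cancel, ← two_smul ℝ,
        smul_smul]
      norm_num
    rw [hT, ← h3]; abel
  have h4 : hs.A (val (antisymPart L C) (Pv f)) = -hs.K f :=
    boundedA_apply_of_mem_closure _ _ _
      (LinearPMap.le_graph_of_le (TPi L C Pv).le_closure (hs.mem_graph_TPi_of_mem hPf))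
  rwa [h2, map_sub, h4, sub_neg_eq_add, inner_add_left] at h1

/-- With `u = 𝒜f` and `w` the image of `u` under the closure of 𝒯Π, both `⟪𝒜f, ℒf⟫` and `m ‖u‖² +
‖w‖²` equal `-⟪f - Πf, w⟫`. The second equality gives `‖w‖ ≤ ‖f - Πf‖`, the first then gives the
bound. -/
theorem inner_A_le : ∀ q ∈ L.graph, ⟪hs.A q.1, q.2⟫_ℝ ≤ ‖q.1 - Pv q.1‖ ^ 2 := by
  refine hs.core_induction (isClosed_le (by fun_prop) (by fun_prop)) fun f hf => ?_
  have hz := hs.mem_adjoint_TPi hf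
  set z := Pv (val (antisymPart L C) f) with hzdef
  have hA : hs.A f = hs.res z := hs.A_apply hf
  have h1 := hs.mem_closure_res z
  obtain ⟨h2, h3⟩ := hs.of_mem_closure_TPi h1
  have h4 := h3 _ (mem_graph_val (hs.mem_domain hf))
  simp only at h2 h4
  have h5 : Pv (hs.res z) = hs.res z := hs.proj_res (hs.idem _)
  rw [h5, ← hA, real_inner_comm] at h4
  have h6 := norm_sq_resolventOp hs.dense_TPi hs.isClosable_TPi hs.pos z
  have h7 := inner_adjoint_closure hs.dense_TPi hs.isClosable_TPi h1 hz
  change m * ‖hs.res z‖ ^ 2 + ‖hs.clRes z‖ ^ 2 = ⟪z, hs.res z⟫_ℝ at h6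
  simp only [inner_neg_right] at h7
  rw [real_inner_comm] at h6 h7
  rw [hs.inner_eq_inner_sub h2] at h4 h7
  have h8 := abs_real_inner_le_norm (f - Pv f) (hs.clRes z)
  have h9 := neg_abs_le ⟪f - Pv f, hs.clRes z⟫_ℝ
  have h10 := mul_nonneg hs.pos.le (sq_nonneg ‖hs.res z‖)
  have h11 : ‖hs.clRes z‖ ≤ ‖f - Pv f‖ := by
    by_contra! hlt
    nlinarith [norm_nonneg (f - Pv f), norm_nonneg (hs.clRes z)]
  simp only
  rw [h4]
  nlinarith [norm_nonneg (f - Pv f), norm_nonneg (hs.clRes z)]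

theorem semigroup_e (t : ℝ≥0) : P t e = e :=
  hs.generates.semigroup.apply_eq_self hs.inner_e t

theorem mem_graph_e : (e, 0) ∈ L.graph :=
  (hs.generates.mem_graph_iff _ _).2 (by simp [hs.semigroup_e])

theorem inner_e_of_mem_graph {f g : H} (h : (f, g) ∈ L.graph) : ⟪g, e⟫_ℝ = 0 := by
  have h1 := ((hs.generates.mem_graph_iff _ _).1 h).inner (tendsto_const_nhds (x := e)) (𝕜 := ℝ)
  refine tendsto_nhds_unique h1 (tendsto_const_nhds.congr fun t => ?_)
  rw [real_inner_smul_left, inner_sub_left, real_inner_comm, hs.inner_e, real_inner_comm,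
    sub_self, mul_zero]

/-- Since `ℒe = 0` and `Πe = e`, the remainder bound at `e` gives `⟪Ke, e⟫ = 0`; the energy identity
turns this into `‖Ke‖² = -m ‖clRes e‖²`. -/
theorem K_e : hs.K e = 0 := by
  have h1 := hs.remainder_le _ hs.mem_graph_e
  simp only [map_zero, inner_zero_left, zero_add, hs.proj_e, sub_self, norm_zero, mul_zero,
    zero_mul, abs_nonpos_iff] at h1
  have h2 := norm_sq_resolventOp hs.dense_TPi hs.isClosable_TPi hs.pos e
  change m * ‖hs.res e‖ ^ 2 + ‖hs.clRes e‖ ^ 2 = ⟪e, hs.res e⟫_ℝ at h2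
  have h3 : ‖hs.K e‖ ^ 2 = ⟪hs.K e, e⟫_ℝ - m * (⟪e, hs.res e⟫_ℝ - m * ‖hs.res e‖ ^ 2) := by
    rw [← real_inner_self_eq_norm_sq (hs.K e), K_apply]
    simp only [inner_sub_left, inner_sub_right, real_inner_smul_left, real_inner_smul_right,
      real_inner_comm e (hs.res e)]
    rw [real_inner_self_eq_norm_sq (hs.res e)]
    ring
  rw [h1, ← h2] at h3
  have h4 := mul_nonneg hs.pos.le (sq_nonneg ‖hs.clRes e‖)
  rw [← norm_eq_zero, ← sq_eq_zero_iff]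
  refine le_antisymm ?_ (sq_nonneg _)
  linarith

end OperatorSetting

end Setting

/-- The algebra behind the dissipation of the modified entropy. -/
theorem dissipation_le {a b r s ψ δ R₀ x y K q p p' : ℝ} (ha : 0 < a) (hb : 1 ≤ b) (hδ : 0 < δ)
    (hδ₁ : δ * (a * (R₀ ^ 2 * b + 2)) ≤ 1) (h1 : y ^ 2 ≤ b * K + r * ψ)
    (h2 : x ^ 2 ≤ a * -q + s * ψ) (h3 : p + K ≤ R₀ * x * y) (h4 : p' ≤ x ^ 2) :
    q + δ * (p' + p) ≤ -(δ / b / 2 * (x ^ 2 + y ^ 2)) + ψ * (s / a + δ * r / b) := by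
  have hb0 : 0 < b := by linarith
  have h7 : (x ^ 2 - s * ψ) / a ≤ -q := by
    rw [div_le_iff₀ ha]; linarith
  have h8 : (y ^ 2 - r * ψ) / b ≤ K := by
    rw [div_le_iff₀ hb0]; linarith
  -- The budget for `x²`: part of `δ R₀² b x²` pays for the cross term, one `δ x²` for `p'`, and the
  -- other for the decay of `x²`.
  have h9 : δ * (R₀ ^ 2 * b + 2) * x ^ 2 ≤ x ^ 2 / a := by
    rw [le_div_iff₀ ha]
    nlinarith [sq_nonneg x]
  -- Young's inequality, weighted so that only half of the gain `y² / b` is spent.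
  have h10 : R₀ * x * y ≤ R₀ ^ 2 * b * x ^ 2 / 2 + y ^ 2 / b / 2 := by
    have h11 : 0 ≤ (R₀ * b * x - y) ^ 2 / b / 2 := by positivity
    have h12 : (R₀ * b * x - y) ^ 2 / b / 2
        = R₀ ^ 2 * b * x ^ 2 / 2 + y ^ 2 / b / 2 - R₀ * x * y := by
      field_simp; ring
    linarith
  have h13 : δ / b / 2 * x ^ 2 ≤ δ * x ^ 2 := by
    have : δ / b / 2 ≤ δ := by
      rw [div_div, div_le_iff₀ (by positivity)]; nlinarith
    gcongr
  have h14 : 0 ≤ δ * (R₀ ^ 2 * b * x ^ 2) := by positivity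
  have h15 := mul_le_mul_of_nonneg_left h3 hδ.le
  have h16 := mul_le_mul_of_nonneg_left h4 hδ.le
  have h17 := mul_le_mul_of_nonneg_left h8 hδ.le
  have h18 := mul_le_mul_of_nonneg_left h10 hδ.le
  have h20 : (x ^ 2 - s * ψ) / a = x ^ 2 / a - ψ * (s / a) := by ring
  have h21 : δ * ((y ^ 2 - r * ψ) / b) = δ * (y ^ 2 / b) - ψ * (δ * r / b) := by ring
  have h22 : δ / b / 2 * (x ^ 2 + y ^ 2) = δ / b / 2 * x ^ 2 + δ * (y ^ 2 / b) / 2 := by ring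
  rw [h20] at h7
  rw [h21] at h17
  rw [h22]
  linarith

/-! ### Weak coercivity of K and decay of the modified entropy. -/

namespace OperatorSetting

variable {H : Type*} [NormedAddCommGroup H] [InnerProductSpace ℝ H] [CompleteSpace H]
  {L : H →ₗ.[ℝ] H} {P : ℝ≥0 → H →L[ℝ] H} {C : Submodule ℝ H} {Pv : H →L[ℝ] H} {e : H}
  {m R₀ : ℝ} (hs : OperatorSetting L P C Pv e m R₀)

include hs

theorem inner_K_nonneg (h : H) : 0 ≤ ⟪hs.K h, h⟫_ℝ := by
  rw [K_apply, inner_sub_left, real_inner_smul_left, real_inner_self_eq_norm_sq]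
  have h1 : m * ‖hs.res h‖ ≤ ‖h‖ := hs.isNonnegSelfAdjoint.mul_norm_resolvent_le hs.pos h
  have h2 := real_inner_le_norm (hs.res h) h
  have h3 := mul_le_mul_of_nonneg_right h1 (norm_nonneg h)
  have h4 := mul_le_mul_of_nonneg_left h2 hs.pos.le
  nlinarith

theorem res_of_mem_graph_opG {u z : H} (h : (u, z) ∈ (opG L C Pv).graph) : hs.res z = hs.K u := by
  have h1 : hs.res (m • u + z) = u := hs.isNonnegSelfAdjoint.resolvent_add hs.pos h
  rw [map_add, map_smul] at h1
  rw [K_apply]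
  exact eq_sub_of_add_eq' h1

/-- `Ke = 0` means `e = m (m + G)⁻¹ e`; moving the resolvent onto `z = Gu` yields `m ⟪e, Ku⟫ = m
⟪Ke, u⟫ = 0`. -/
theorem inner_e_of_mem_graph_opG {u z : H} (h : (u, z) ∈ (opG L C Pv).graph) : ⟪e, z⟫_ℝ = 0 := by
  have h1 := hs.K_e
  rw [K_apply, sub_eq_zero] at h1
  rw [h1, real_inner_smul_left, hs.inner_res_left, hs.res_of_mem_graph_opG h, ← hs.inner_K_left,
    hs.K_e, inner_zero_left, mul_zero]

theorem proj_of_mem_graph_opG {u z : H} (h : (u, z) ∈ (opG L C Pv).graph) : Pv z = z := by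
  obtain ⟨y, -, h2⟩ := mem_graph_pcomp.1 h
  exact hs.proj_of_mem_adjoint h2

/-- A weak Poincaré inequality for the closure of `𝒯 Π` along the orbit of `f` under
`(e^{-tG})` gives a weak coercivity inequality for `G (m + G)⁻¹`. -/
theorem norm_sq_le_inner_K {f : H} {a c : ℝ} (ha : 0 ≤ a)
    (hwp : ∀ t : ℝ≥0, ∀ y, (hs.isNonnegSelfAdjoint.semigroup t f, y) ∈ (TPi L C Pv).closure.graph →
      ‖Pv (hs.isNonnegSelfAdjoint.semigroup t f)
        - ⟪e, hs.isNonnegSelfAdjoint.semigroup t f⟫_ℝ • e‖ ^ 2 ≤ a * ‖y‖ ^ 2 + c) (hc : 0 ≤ c) :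
    ‖Pv f - ⟪e, f⟫_ℝ • e‖ ^ 2 ≤ (1 + m * a) * ⟪hs.K f, f⟫_ℝ + c := by
  set Q := hs.isNonnegSelfAdjoint.semigroup with hQdef
  have hQ : Generates (-opG L C Pv) Q := hs.isNonnegSelfAdjoint.generates_semigroup
  let J : H →L[ℝ] H := Pv - (innerSL ℝ e).smulRight e
  have hJ : ∀ h, J h = Pv h - ⟪e, h⟫_ℝ • e := fun h => rfl
  set u : ℝ → H := fun t => Q t.toNNReal f with hu
  have hucont : Continuous u := (hQ.semigroup.continuous f).comp continuous_real_toNNReal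
  -- `D` is the defect in the claim along the orbit. The hypothesis `hwp` gives `D' ≥ 2m D`, so a
  -- positive value would grow exponentially, whereas `D` is bounded above.
  set D : ℝ → ℝ := fun t => ‖J (u t)‖ ^ 2 - c - (1 + m * a) * ⟪hs.K (u t), u t⟫_ℝ with hD
  have hDcont : Continuous D := by fun_prop
  have hm := hs.pos
  -- Only positive times are usable, since `f` itself need not lie in the domain of G; at other
  -- times `d` is a dummy value.
  have hdata : ∀ t : ℝ, ∃ d : ℝ, 0 < t → HasDerivWithinAt D d (Ici t) t ∧ 2 * m * D t ≤ d := by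
    intro t
    by_cases ht : 0 < t
    swap
    · exact ⟨0, fun h => absurd h ht⟩
    obtain ⟨z, hz⟩ := LinearPMap.mem_domain_iff.1
      (hs.isNonnegSelfAdjoint.semigroup_mem_domain (Real.toNNReal_pos.2 ht) f)
    obtain ⟨y, hy, hyz⟩ := mem_graph_pcomp.1 hz
    have hd : HasDerivWithinAt u (-z) (Ici t) t :=
      hQ.hasDerivWithinAt ht.le (mem_graph_neg.2 (by rw [neg_neg]; exact hz))
    change (u t, z) ∈ _ at hz
    change (u t, y) ∈ _ at hy
    have hJd : HasDerivWithinAt (fun t => J (u t)) (J (-z)) (Ici t) t :=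
      J.hasFDerivAt.comp_hasDerivWithinAt t hd
    have hKd : HasDerivWithinAt (fun t => hs.K (u t)) (hs.K (-z)) (Ici t) t :=
      hs.K.hasFDerivAt.comp_hasDerivWithinAt t hd
    refine ⟨_, fun _ => ⟨(hJd.norm_sq.sub_const c).sub
      ((hKd.inner ℝ hd).const_mul (1 + m * a)), ?_⟩⟩
    have hPz := hs.proj_of_mem_graph_opG hz
    have hez := hs.inner_e_of_mem_graph_opG hz
    have hJz : J z = z := by rw [hJ, hPz, hez, zero_smul, sub_zero]
    have h1 : ⟪u t, z⟫_ℝ = ‖y‖ ^ 2 := by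
      have := inner_adjoint_closure hs.dense_TPi hs.isClosable_TPi hy hyz
      rw [← this, real_inner_self_eq_norm_sq]
    have h2 : ⟪J (u t), z⟫_ℝ = ‖y‖ ^ 2 := by
      rw [hJ, inner_sub_left, hs.symm, hPz, real_inner_smul_left, hez, mul_zero, sub_zero, h1]
    have h3 : ⟪hs.K (u t), z⟫_ℝ = ‖y‖ ^ 2 - m * ⟪hs.K (u t), u t⟫_ℝ := by
      conv_lhs => rw [K_apply, inner_sub_left, real_inner_smul_left, hs.inner_res_left,
        hs.res_of_mem_graph_opG hz, h1, ← hs.inner_K_left]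
    have h4 : ⟪hs.K z, u t⟫_ℝ = ‖y‖ ^ 2 - m * ⟪hs.K (u t), u t⟫_ℝ := by
      rw [hs.inner_K_left, real_inner_comm, h3]
    have h5 := hwp t.toNNReal y hy
    change ‖J (u t)‖ ^ 2 ≤ _ at h5
    simp only [map_neg, hJz, inner_neg_right, inner_neg_left, h2, h3, h4, hD]
    nlinarith
  choose d hd using hdata
  obtain ⟨N, hN⟩ : ∃ N, ∀ t, D t ≤ N := by
    refine ⟨(‖J‖ * ‖f‖) ^ 2, fun t => ?_⟩
    have h1 : ‖J (u t)‖ ≤ ‖J‖ * ‖f‖ := (J.le_opNorm _).trans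
      (mul_le_mul_of_nonneg_left (hQ.semigroup.norm_apply_le _ f) (norm_nonneg _))
    have h2 := mul_nonneg (by positivity : 0 ≤ 1 + m * a) (hs.inner_K_nonneg (u t))
    have h3 := pow_le_pow_left₀ (norm_nonneg _) h1 2
    simp only [hD]
    linarith
  have hDpos : ∀ s, 0 < s → D s ≤ 0 := by
    intro s hsp
    have key : ∀ T, s ≤ T → D s ≤ Real.exp (-(2 * m) * (T - s)) * N := by
      intro T hT
      -- Grönwall for `-D` with the negative rate `-2m` reads `D s ≤ e^{-2m(T-s)} D T`, and `T → ∞`.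
      have h1 := le_exp_mul_of_deriv_right_le (v := fun t => -D t) (v' := fun t => -d t)
        (l := -(2 * m)) hT hDcont.neg.continuousOn
        (fun t ht => ((hd t (hsp.trans_le ht.1)).1).neg)
        (fun t ht => by linarith [(hd t (hsp.trans_le ht.1)).2])
      rw [neg_neg] at h1
      have h2 : Real.exp (-(2 * m) * (T - s)) * Real.exp (2 * m * (T - s)) = 1 := by
        rw [← Real.exp_add]; simp
      have h3 := mul_le_mul_of_nonneg_left h1 (Real.exp_pos (-(2 * m) * (T - s))).le
      have h4 := mul_le_mul_of_nonneg_left (hN T) (Real.exp_pos (-(2 * m) * (T - s))).le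
      rw [← mul_assoc, h2] at h3
      linarith
    have hlim : Tendsto (fun T : ℝ => Real.exp (-(2 * m) * (T - s)) * N) atTop (𝓝 0) := by
      have h1 : Tendsto (fun T : ℝ => -(2 * m) * (T - s)) atTop atBot :=
        (tendsto_atTop_add_const_right _ (-s) tendsto_id).const_mul_atTop_of_neg (by linarith)
      simpa using (Real.tendsto_exp_atBot.comp h1).mul_const N
    exact ge_of_tendsto hlim (eventually_atTop.2 ⟨s, key⟩)
  have h0 : D 0 ≤ 0 := by
    refine le_of_tendsto ((hDcont.tendsto 0).mono_left (nhdsWithin_le_nhds (s := Ioi 0))) ?_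
    filter_upwards [self_mem_nhdsWithin] with s hsp using hDpos s hsp
  have hu0 : u 0 = f := by
    simp only [hu, Real.toNNReal_zero, hQ.semigroup.zero, ContinuousLinearMap.id_apply]
  simp only [hD, hu0, hJ] at h0
  linarith

/-- Decay of the modified entropy `‖f‖² / 2 + δ ⟪𝒜 f, f⟫`. -/
theorem norm_sq_semigroup_le {f : H} (hf : f ∈ L.domain) {a b r s ψ δ : ℝ} (ha : 0 < a)
    (hb : 1 ≤ b) (hr : 0 ≤ r) (hsn : 0 ≤ s) (hψ : 0 ≤ ψ) (hδ : 0 < δ)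
    (hδ₁ : δ * (a * (R₀ ^ 2 * b + 2)) ≤ 1) (hδ₂ : δ * (1 / (2 * √m)) < 1)
    (hcoer : ∀ t, ‖Pv (P t f) - ⟪e, P t f⟫_ℝ • e‖ ^ 2 ≤ b * ⟪hs.K (P t f), P t f⟫_ℝ + r * ψ)
    (hdiss : ∀ t g, (P t f, g) ∈ L.graph →
      ‖P t f - Pv (P t f)‖ ^ 2 ≤ a * -⟪g, P t f⟫_ℝ + s * ψ) (t : ℝ≥0) :
    ‖P t f - ⟪e, f⟫_ℝ • e‖ ^ 2 ≤
      (1 + δ * (1 / (2 * √m))) / (1 - δ * (1 / (2 * √m)))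
          * Real.exp (-(δ / b / (1 + δ * (1 / (2 * √m)))) * t) * ‖f - ⟪e, f⟫_ℝ • e‖ ^ 2
        + 2 / (1 - δ * (1 / (2 * √m)))
          * (ψ * (s / a + δ * r / b) / (δ / b / (1 + δ * (1 / (2 * √m))))) := by
  have hk0 : 0 < 1 / (2 * √m) := by have := Real.sqrt_pos.2 hs.pos; positivity
  set k := 1 / (2 * √m) with hk
  have hb0 : 0 < b := by linarith
  set l := δ / b / (1 + δ * k) with hl
  have hl0 : 0 < l := by positivity
  set θ := ψ * (s / a + δ * r / b) with hθ
  have hθ0 : 0 ≤ θ := by positivity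
  set c := ⟪e, f⟫_ℝ with hc
  -- Centring: `e` is fixed by the semigroup and killed by K and by `1 - Π`, so the hypotheses on
  -- the orbit of `f` become statements about the mean-zero orbit of `f₀`.
  set f₀ := f - c • e with hf₀
  obtain ⟨g, hg⟩ := LinearPMap.mem_domain_iff.1 hf
  have hg₀ : (f₀, g) ∈ L.graph := by
    have := L.graph.sub_mem hg (L.graph.smul_mem c hs.mem_graph_e)
    simpa using this
  set u : ℝ → H := fun t => P t.toNNReal f₀ with hu
  have hPf : ∀ t : ℝ, P t.toNNReal f = u t + c • e := by
    intro t
    simp [hu, hf₀, hs.semigroup_e]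
  have hee : ⟪e, e⟫_ℝ = 1 := by rw [real_inner_self_eq_norm_sq, hs.norm_e, one_pow]
  have heu : ∀ t, ⟪e, u t⟫_ℝ = 0 := by
    intro t
    simp only [hu, hs.inner_e, hf₀, inner_sub_right, real_inner_smul_right, hee, ← hc]
    ring
  have hpyth : ∀ h, ‖h‖ ^ 2 = ‖h - Pv h‖ ^ 2 + ‖Pv h‖ ^ 2 := by
    intro h
    have h1 : ⟪h - Pv h, Pv h⟫_ℝ = 0 := by
      rw [← hs.symm, map_sub, hs.idem, sub_self, inner_zero_left]
    have := norm_add_sq_real (h - Pv h) (Pv h)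
    rw [h1, sub_add_cancel] at this
    linarith
  have hAbound : ∀ h, |⟪hs.A h, h⟫_ℝ| ≤ k * (1 / 2 * ‖h‖ ^ 2) := by
    intro h
    refine (hs.abs_inner_A_le h h).trans (mul_le_mul_of_nonneg_left ?_ hk0.le)
    rw [hpyth h]
    nlinarith [sq_nonneg (‖h - Pv h‖ - ‖Pv h‖)]
  set Ent : H → ℝ := fun h => 1 / 2 * ‖h‖ ^ 2 + δ * ⟪hs.A h, h⟫_ℝ with hE
  have hEup : ∀ h, Ent h ≤ 1 / 2 * (1 + δ * k) * ‖h‖ ^ 2 := by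
    intro h
    have := mul_le_mul_of_nonneg_left ((le_abs_self _).trans (hAbound h)) hδ.le
    simp only [hE]; linarith
  have hElow : ∀ h, 1 / 2 * (1 - δ * k) * ‖h‖ ^ 2 ≤ Ent h := by
    intro h
    have := mul_le_mul_of_nonneg_left ((neg_le_abs _).trans (hAbound h)) hδ.le
    simp only [hE]; linarith
  have hucont : Continuous u :=
    (hs.generates.semigroup.continuous f₀).comp continuous_real_toNNReal
  -- Subtracting the equilibrium value `θ / l` turns `Ent' ≤ -l Ent + θ` into a homogeneous
  -- inequality.
  have hmain := le_exp_mul_of_deriv_right_le (v := fun t => Ent (u t) - θ / l)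
    (v' := fun t => 1 / 2 * (2 * ⟪u t, P t.toNNReal g⟫_ℝ)
      + δ * (⟪hs.A (u t), P t.toNNReal g⟫_ℝ + ⟪hs.A (P t.toNNReal g), u t⟫_ℝ))
    (l := l) (a := 0) (b := t) t.2
    (Continuous.continuousOn (by simp only [hE]; fun_prop))
    (fun t ht => by
      have hd : HasDerivWithinAt u (P t.toNNReal g) (Ici t) t :=
        hs.generates.hasDerivWithinAt ht.1 (hs.generates.mem_graph hg₀ _)
      have hAd : HasDerivWithinAt (fun t => hs.A (u t)) (hs.A (P t.toNNReal g)) (Ici t) t :=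
        hs.A.hasFDerivAt.comp_hasDerivWithinAt t hd
      exact ((hd.norm_sq.const_mul (1 / 2)).add ((hAd.inner ℝ hd).const_mul δ)).sub_const _)
    (fun t ht => by
      have hgr := hs.generates.mem_graph hg₀ t.toNNReal
      have h1 := hcoer t.toNNReal
      have h2 := hdiss t.toNNReal _ (hs.generates.mem_graph hg t.toNNReal)
      have h3 := hs.remainder_le _ hgr
      have h4 := hs.inner_A_le _ hgr
      have hge := hs.inner_e_of_mem_graph hgr
      change ⟪P t.toNNReal g, e⟫_ℝ = 0 at hge
      set g' := P t.toNNReal g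
      change |⟪hs.A g', u t⟫_ℝ + ⟪hs.K (u t), u t⟫_ℝ| ≤ R₀ * ‖u t - Pv (u t)‖ * ‖Pv (u t)‖ at h3
      change ⟪hs.A (u t), g'⟫_ℝ ≤ ‖u t - Pv (u t)‖ ^ 2 at h4
      rw [hPf] at h1 h2
      have e1 : Pv (u t + c • e) - ⟪e, u t + c • e⟫_ℝ • e = Pv (u t) := by
        rw [map_add, map_smul, hs.proj_e, inner_add_right, heu, real_inner_smul_right, hee,
          zero_add, mul_one, add_sub_cancel_right]
      have e2 : ⟪hs.K (u t + c • e), u t + c • e⟫_ℝ = ⟪hs.K (u t), u t⟫_ℝ := by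
        rw [map_add, map_smul, hs.K_e, smul_zero, add_zero, hs.inner_K_left, map_add, map_smul,
          hs.K_e, smul_zero, add_zero, hs.inner_K_left]
      have e3 : u t + c • e - Pv (u t + c • e) = u t - Pv (u t) := by
        rw [map_add, map_smul, hs.proj_e]; abel
      have e4 : ⟪g', u t + c • e⟫_ℝ = ⟪g', u t⟫_ℝ := by
        rw [inner_add_right, real_inner_smul_right, hge, mul_zero, add_zero]
      rw [e1, e2] at h1
      rw [e3, e4] at h2
      rw [real_inner_comm g' (u t)]
      have h5 := hEup (u t)
      rw [hpyth (u t)] at h5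
      have h3' := (abs_le.1 h3).2
      set x := ‖u t - Pv (u t)‖
      set y := ‖Pv (u t)‖
      set K := ⟪hs.K (u t), u t⟫_ℝ
      have h6 : l * Ent (u t) ≤ δ / b / 2 * (x ^ 2 + y ^ 2) := by
        calc l * Ent (u t) ≤ l * (1 / 2 * (1 + δ * k) * (x ^ 2 + y ^ 2)) := by gcongr
          _ = _ := by rw [hl]; field_simp
      have h7 := dissipation_le ha hb hδ hδ₁ h1 h2 h3' h4
      have h8 : -l * (Ent (u t) - θ / l) = -(l * Ent (u t)) + θ := by
        rw [mul_sub, neg_mul, neg_mul, mul_div_cancel₀ _ hl0.ne']; ring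
      rw [h8]
      linarith)
  rw [sub_zero] at hmain
  have hu0 : u 0 = f₀ := by
    simp only [hu, Real.toNNReal_zero, hs.generates.semigroup.zero, ContinuousLinearMap.id_apply]
  have hut : P t f - c • e = u t := by
    have := hPf t
    rw [Real.toNNReal_coe] at this
    rw [this, add_sub_cancel_right]
  rw [hut]
  simp only [hu0] at hmain
  have h1 := hElow (u t)
  have h2 := mul_le_mul_of_nonneg_left (hEup f₀) (Real.exp_pos (-l * t)).le
  have h3 : 0 ≤ Real.exp (-l * t) * (θ / l) := by positivity
  have h4 : 0 < 1 - δ * k := by linarith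
  have h5 : 1 / 2 * (1 - δ * k) * ‖u t‖ ^ 2
      ≤ Real.exp (-l * t) * (1 / 2 * (1 + δ * k) * ‖f₀‖ ^ 2) + θ / l := by
    linarith
  have h6 : ‖u t‖ ^ 2 = 2 / (1 - δ * k) * (1 / 2 * (1 - δ * k) * ‖u t‖ ^ 2) := by
    field_simp
  rw [h6]
  refine (mul_le_mul_of_nonneg_left h5 (by positivity)).trans (le_of_eq ?_)
  field_simp

end OperatorSetting

/-! ### The velocity average as an orthogonal projection, and the constant function. -/

section VelocityAverage

variable {X V : Type*} [MeasurableSpace X] [MeasurableSpace V]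
  {π : Measure X} {ν : Measure V} [IsProbabilityMeasure π] [IsProbabilityMeasure ν]

theorem inner_velocityAverage_eq (f g : L2 π ν) :
    ⟪velocityAverage π ν f, g⟫_ℝ = ∫ x, (∫ w, f (x, w) ∂ν) * ∫ w, g (x, w) ∂ν ∂π := by
  have h1 : ⟪velocityAverage π ν f, g⟫_ℝ
      = ∫ z, (∫ w, f (z.1, w) ∂ν) * g z ∂(π.prod ν) := by
    rw [L2.inner_def]
    refine integral_congr_ae ?_
    filter_upwards [coeFn_velocityAverage f] with z hz
    rw [hz]
    simp [mul_comm]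
  have h2 : Integrable (fun z : X × V => (∫ w, f (z.1, w) ∂ν) * g z) (π.prod ν) :=
    (memLp_avg f).integrable_mul (Lp.memLp g)
  rw [h1, integral_prod _ h2]
  simp only [integral_const_mul]

theorem inner_velocityAverage_left (f g : L2 π ν) :
    ⟪velocityAverage π ν f, g⟫_ℝ = ⟪f, velocityAverage π ν g⟫_ℝ := by
  rw [real_inner_comm (velocityAverage π ν g) f, inner_velocityAverage_eq,
    inner_velocityAverage_eq]
  simp only [mul_comm]

theorem velocityAverage_eq_self {f : L2 π ν} {F : X → ℝ}
    (h : f =ᵐ[π.prod ν] fun z => F z.1) : velocityAverage π ν f = f := by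
  refine Lp.ext ?_
  have h1 := Measure.ae_ae_of_ae_prod h
  filter_upwards [coeFn_velocityAverage f, h, ae_fst (ν := ν) h1] with z hz hfz hz1
  rw [hz, hfz, integral_congr_ae hz1]
  simp

theorem velocityAverage_idem (f : L2 π ν) :
    velocityAverage π ν (velocityAverage π ν f) = velocityAverage π ν f :=
  velocityAverage_eq_self (F := fun x => ∫ w, f (x, w) ∂ν) (coeFn_velocityAverage f)

variable (π ν) in
/-- The constant function `1`. -/
def oneL2 : L2 π ν := Lp.const 2 (π.prod ν) 1

theorem coeFn_oneL2 : oneL2 π ν =ᵐ[π.prod ν] fun _ => 1 := Lp.coeFn_const _ _ _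

theorem velocityAverage_oneL2 : velocityAverage π ν (oneL2 π ν) = oneL2 π ν :=
  velocityAverage_eq_self (F := fun _ => 1) coeFn_oneL2

theorem inner_oneL2 (f : L2 π ν) : ⟪oneL2 π ν, f⟫_ℝ = ∫ z, f z ∂(π.prod ν) := by
  rw [L2.inner_def]
  refine integral_congr_ae ?_
  filter_upwards [coeFn_oneL2 (π := π) (ν := ν)] with z hz
  simp [hz]

theorem norm_oneL2 : ‖oneL2 π ν‖ = 1 := by
  have h : ⟪oneL2 π ν, oneL2 π ν⟫_ℝ = 1 := by
    rw [inner_oneL2, integral_congr_ae coeFn_oneL2]; simp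
  rw [real_inner_self_eq_norm_sq] at h
  exact (pow_eq_one_iff_of_nonneg (norm_nonneg _) two_ne_zero).1 h

theorem meanL2_eq (f : L2 π ν) : meanL2 π ν f = ⟪oneL2 π ν, f⟫_ℝ • oneL2 π ν := by
  rw [inner_oneL2, meanL2]
  refine Lp.ext ?_
  filter_upwards [Lp.coeFn_const 2 (π.prod ν) (∫ z, f z ∂(π.prod ν)),
    Lp.coeFn_smul (∫ z, f z ∂(π.prod ν)) (oneL2 π ν), coeFn_oneL2 (π := π) (ν := ν)]
    with z h1 h2 h3
  rw [h1, h2, Pi.smul_apply, h3]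
  simp

end VelocityAverage

/-! ### From the functional inequalities to the estimate at fixed `r`, and the infimum over `r`. -/

section Assembly

variable {X V : Type*} [MeasurableSpace X] [MeasurableSpace V]
  {π : Measure X} {ν : Measure V} [IsProbabilityMeasure π] [IsProbabilityMeasure ν]
  {L : L2 π ν →ₗ.[ℝ] L2 π ν} {P : ℝ≥0 → L2 π ν →L[ℝ] L2 π ν} {C : Submodule ℝ (L2 π ν)}
  {Ψ : L2 π ν → ℝ≥0∞} {α₁ α₂ : ℝ → ℝ} {m₂ R₀ : ℝ}

theorem operatorSetting (hm₂ : 0 < m₂) (hcore : CoreCondition L P C)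
    (hstable : ∀ f ∈ C, velocityAverage π ν f ∈ C) (hproj : ProjectionCondition L C)
    (hrem : RemainderCondition m₂ R₀ L C) :
    OperatorSetting L P C (velocityAverage π ν) (oneL2 π ν) m₂ R₀ where
  isClosed := hcore.isClosed
  generates := hcore.generates
  core := hcore.core
  dense := hcore.dense
  le_adjoint_domain := hcore.le_adjoint_domain
  stable := hstable
  symm := inner_velocityAverage_left
  idem := velocityAverage_idem
  range_le_ker := hproj.range_le_ker
  proj_T_proj := hproj.proj_T_proj
  norm_e := norm_oneL2
  proj_e := velocityAverage_oneL2
  inner_e t f := by rw [inner_oneL2, inner_oneL2, hcore.stationary]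
  pos := hm₂
  remainder := hrem

theorem le_of_ofReal_le {x a r ψ : ℝ} {Y : ℝ≥0∞} (ha : 0 ≤ a) (hr : 0 ≤ r) (hψ : 0 ≤ ψ)
    (hY : Y ≤ ENNReal.ofReal ψ)
    (h : ENNReal.ofReal x ≤ ENNReal.ofReal a + ENNReal.ofReal r * Y) : x ≤ a + r * ψ := by
  have h1 : ENNReal.ofReal x ≤ ENNReal.ofReal (a + r * ψ) := by
    rw [ENNReal.ofReal_add ha (by positivity), ENNReal.ofReal_mul hr]
    exact h.trans (by gcongr)
  exact (ENNReal.ofReal_le_ofReal_iff (by positivity)).1 h1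

/-- The second weak Poincaré inequality is known only on the core. The approximants of the condition
on Ψ carry it to D(ℒ), with an error `η` that is sent to `0`; on the core 𝒮 and ℒ have the same
quadratic form. -/
theorem OperatorSetting.sub_proj_le
    (hs : OperatorSetting L P C (velocityAverage π ν) (oneL2 π ν) m₂ R₀)
    (hΨ : PsiCondition L P C Ψ) (hwp : WeakPoincareCondition L C Ψ α₁ α₂) {s ψ : ℝ} (hsp : 0 < s)
    (hψ : 0 ≤ ψ) {f g : L2 π ν} (hfg : (f, g) ∈ L.graph) (hf : Ψ f ≤ ENNReal.ofReal ψ) :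
    ‖f - velocityAverage π ν f‖ ^ 2 ≤ α₂ s * -⟪g, f⟫_ℝ + s * ψ := by
  obtain ⟨u, huC, hu, hlim, hlimΨ⟩ := hΨ.approx f (LinearPMap.mem_domain_of_mem_graph hfg)
  rw [val_eq_of_mem_graph hfg, inner_neg_left] at hlim
  have hq : 0 ≤ -⟪g, f⟫_ℝ := neg_nonneg.2 (hs.generates.inner_nonpos hfg)
  have hα : 0 ≤ α₂ s := zero_le_one.trans (hwp.one_le₂ s hsp)
  have key : ∀ η : ℝ, 0 < η →
      ‖f - velocityAverage π ν f‖ ^ 2 ≤ α₂ s * (-⟪g, f⟫_ℝ + η) + s * (ψ + η) := by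
    intro η hη
    have h1 : ∀ᶠ n in atTop, ((⟪-val L (u n), u n⟫_ℝ : ℝ) : EReal) < ((-⟪g, f⟫_ℝ + η : ℝ) : EReal) :=
      eventually_lt_of_limsup_lt (hlim.trans_lt (EReal.coe_lt_coe_iff.2 (by linarith)))
    have h2 : ∀ᶠ n in atTop, Ψ (u n) < ENNReal.ofReal (ψ + η) :=
      eventually_lt_of_limsup_lt (hlimΨ.trans_lt (hf.trans_lt
        ((ENNReal.ofReal_lt_ofReal_iff (by positivity)).2 (by linarith))))
    have h3 : Tendsto (fun n => ‖u n - velocityAverage π ν (u n)‖ ^ 2) atTop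
        (𝓝 (‖f - velocityAverage π ν f‖ ^ 2)) :=
      ((hu.sub (((velocityAverage π ν).continuous.tendsto f).comp hu)).norm).pow 2
    refine le_of_tendsto h3 ?_
    filter_upwards [h1, h2] with n hn1 hn2
    refine le_of_ofReal_le (by positivity) hsp.le (by positivity) hn2.le
      ((hwp.wp₂ (u n) (huC n) s hsp).trans ?_)
    have h4 : ⟪-val (symPart L C) (u n), u n⟫_ℝ = ⟪-val L (u n), u n⟫_ℝ := by
      have h5 := hs.inner_adjoint (huC n) (mem_graph_val (hs.mem_domain (huC n)))
      rw [hs.sym_apply (huC n), inner_neg_left, inner_neg_left, real_inner_smul_left,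
        inner_add_left, real_inner_comm (u n) (val L† (u n)), ← h5]
      ring
    rw [h4]
    have h6 : ⟪-val L (u n), u n⟫_ℝ ≤ -⟪g, f⟫_ℝ + η := (EReal.coe_lt_coe_iff.1 hn1).le
    gcongr
  have hc : Tendsto (fun η : ℝ => α₂ s * (-⟪g, f⟫_ℝ + η) + s * (ψ + η)) (𝓝[>] 0)
      (𝓝 (α₂ s * -⟪g, f⟫_ℝ + s * ψ)) := by
    have : Continuous fun η : ℝ => α₂ s * (-⟪g, f⟫_ℝ + η) + s * (ψ + η) := by fun_prop
    exact (this.tendsto' 0 _ (by simp)).mono_left nhdsWithin_le_nhds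
  exact ge_of_tendsto hc (by filter_upwards [self_mem_nhdsWithin] with η hη using key η hη)

theorem OperatorSetting.proj_sub_mean_le
    (hs : OperatorSetting L P C (velocityAverage π ν) (oneL2 π ν) m₂ R₀)
    (hΨ : PsiCondition L P C Ψ) (hwp : WeakPoincareCondition L C Ψ α₁ α₂) {r ψ : ℝ} (hr : 0 < r)
    (hψ : 0 ≤ ψ) {f : L2 π ν} (hf : Ψ f ≤ ENNReal.ofReal ψ) :
    ‖velocityAverage π ν f - ⟪oneL2 π ν, f⟫_ℝ • oneL2 π ν‖ ^ 2
      ≤ (1 + m₂ * α₁ r) * ⟪hs.K f, f⟫_ℝ + r * ψ := by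
  have hα : 0 ≤ α₁ r := zero_le_one.trans (hwp.one_le₁ r hr)
  refine hs.norm_sq_le_inner_K hα (fun t y hy => ?_) (by positivity)
  have h1 := hwp.wp₁ _ (LinearPMap.mem_domain_of_mem_graph hy) r hr
  rw [val_eq_of_mem_graph hy, meanL2_eq] at h1
  refine le_of_ofReal_le (by positivity) hr.le hψ ?_ h1
  exact (hΨ.proj_le _).trans
    ((hΨ.exp_le _ hs.isNonnegSelfAdjoint.generates_semigroup t f).trans hf)

/-- The decay estimate at a fixed value of `r`. -/
theorem OperatorSetting.norm_sq_le
    (hs : OperatorSetting L P C (velocityAverage π ν) (oneL2 π ν) m₂ R₀)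
    (hΨ : PsiCondition L P C Ψ) (hwp : WeakPoincareCondition L C Ψ α₁ α₂) {f : L2 π ν}
    (hf : f ∈ L.domain) {r ψ a b δ c₁ c₂ : ℝ} (t : ℝ≥0) (hr : 0 < r) (hψ : 0 ≤ ψ)
    (hΨf : Ψ f ≤ ENNReal.ofReal ψ) (ha : a = α₂ (r / α₁ r ^ 2)) (hb : b = 1 + m₂ * α₁ r)
    (hδ : 0 < δ) (hδ₁ : δ * (a * (R₀ ^ 2 * b + 2)) ≤ 1) (hδ₂ : δ * (1 / (2 * √m₂)) < 1)
    (hc₂ : c₂ * (1 + δ * (1 / (2 * √m₂))) ≤ δ / b * (α₁ r ^ 2 * a))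
    (hc₁ : 2 * ((1 + δ * (1 / (2 * √m₂))) / (1 - δ * (1 / (2 * √m₂))))
      * (b / (α₁ r ^ 2 * a * δ) + 1) ≤ c₁)
    (hrt : α₁ r ^ 2 * α₂ (r / α₁ r ^ 2) * Real.log (1 / r) ≤ c₂ * t) :
    ‖P t f - meanL2 π ν f‖ ^ 2 ≤ c₁ * r * (‖f‖ ^ 2 + ψ) := by
  have h1 := hwp.one_le₁ r hr
  have hsp : 0 < r / α₁ r ^ 2 := by positivity
  have h2 : 1 ≤ a := ha ▸ hwp.one_le₂ _ hsp
  have hm := hs.pos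
  have hb1 : 1 ≤ b := by rw [hb]; nlinarith
  have hPΨ : ∀ t, Ψ (P t f) ≤ ENNReal.ofReal ψ := fun t => (hΨ.semigroup_le t f).trans hΨf
  -- The choice `s = r / α₁(r)²` balances the two errors: `s / a` divided by the rate `δ / b` is
  -- again of order `r`.
  have hmain := hs.norm_sq_semigroup_le hf (a := a) (b := b) (r := r) (s := r / α₁ r ^ 2) (ψ := ψ)
    (by linarith) hb1 hr.le hsp.le hψ hδ hδ₁ hδ₂
    (fun t => hb ▸ hs.proj_sub_mean_le hΨ hwp hr hψ (hPΨ t))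
    (fun t g hg => ha ▸ hs.sub_proj_le hΨ hwp hsp hψ hg (hPΨ t)) t
  rw [meanL2_eq]
  refine hmain.trans ?_
  have hk0 : 0 < 1 / (2 * √m₂) := by have := Real.sqrt_pos.2 hm; positivity
  rw [← ha] at hrt
  set k := 1 / (2 * √m₂)
  set A := α₁ r
  have hk1 : 0 < 1 - δ * k := by linarith
  have hA : 0 < A ^ 2 * a := by positivity
  have hexp : Real.exp (-(δ / b / (1 + δ * k)) * t) ≤ r := by
    rw [← Real.le_log_iff_exp_le hr]
    rw [one_div, Real.log_inv] at hrt
    have h3 : c₂ * t * (1 + δ * k) ≤ δ / b * (A ^ 2 * a) * t := by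
      have := mul_le_mul_of_nonneg_right hc₂ t.coe_nonneg
      linarith
    have h4 : -Real.log r * (1 + δ * k) ≤ δ / b * t := by
      refine le_of_mul_le_mul_left ?_ hA
      have := mul_le_mul_of_nonneg_right hrt (by positivity : 0 ≤ 1 + δ * k)
      linarith
    have h5 : -Real.log r ≤ δ / b / (1 + δ * k) * t := by
      rw [div_mul_eq_mul_div, le_div_iff₀ (by positivity)]
      exact h4
    linarith
  have hnorm : ‖f - ⟪oneL2 π ν, f⟫_ℝ • oneL2 π ν‖ ^ 2 ≤ ‖f‖ ^ 2 := by
    rw [norm_sub_sq_real, real_inner_smul_right, norm_smul, norm_oneL2, real_inner_comm f,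
      mul_one, Real.norm_eq_abs, sq_abs]
    nlinarith [sq_nonneg ⟪oneL2 π ν, f⟫_ℝ]
  have h6 : 0 ≤ (1 + δ * k) / (1 - δ * k) := by positivity
  have h7 : 0 ≤ b / (A ^ 2 * a * δ) := by positivity
  have h8 : (1 + δ * k) / (1 - δ * k) ≤ c₁ := by
    refine le_trans ?_ hc₁
    nlinarith [mul_nonneg h6 h7]
  have h9 : 2 / (1 - δ * k) * (ψ * (r / A ^ 2 / a + δ * r / b) / (δ / b / (1 + δ * k)))
      = 2 * ((1 + δ * k) / (1 - δ * k)) * (b / (A ^ 2 * a * δ) + 1) * (r * ψ) := by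
    field_simp
  rw [h9]
  have h10 : (1 + δ * k) / (1 - δ * k) * Real.exp (-(δ / b / (1 + δ * k)) * t)
      * ‖f - ⟪oneL2 π ν, f⟫_ℝ • oneL2 π ν‖ ^ 2 ≤ c₁ * r * ‖f‖ ^ 2 := by
    have := h6.trans h8
    gcongr
  have h11 := mul_le_mul_of_nonneg_right hc₁ (by positivity : 0 ≤ r * ψ)
  linarith

/-- What remains beyond the infimum is that ξ is positive, so that the bound is trivial where Ψ is
infinite. -/
theorem decayBound_of_forall {c₁ c₂ : ℝ} (hc₁ : 0 < c₁) (hc₂ : 0 < c₂)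
    (h₁ : ∀ r, 0 < r → 1 ≤ α₁ r) (h₂ : ∀ r, 0 < r → 1 ≤ α₂ r)
    (h : ∀ t : ℝ≥0, ∀ f ∈ L.domain, Ψ f ≠ ∞ → ∀ r, 0 < r →
      α₁ r ^ 2 * α₂ (r / α₁ r ^ 2) * Real.log (1 / r) ≤ c₂ * t →
      ‖P t f - meanL2 π ν f‖ ^ 2 ≤ c₁ * r * (‖f‖ ^ 2 + (Ψ f).toReal)) :
    DecayBound L P Ψ (xi α₁ α₂ c₁ c₂) := by
  intro t f hf
  set S := {r : ℝ | 0 < r ∧ c₂ * t ≥ α₁ r ^ 2 * α₂ (r / α₁ r ^ 2) * Real.log (1 / r)} with hS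
  have hne : S.Nonempty := ⟨1, one_pos, by simp; positivity⟩
  -- As `α₁, α₂ ≥ 1`, every admissible `r` satisfies `r ≥ exp(-c₂ t)`.
  have hpos : 0 < sInf S := by
    refine (Real.exp_pos (-(c₂ * t))).trans_le (le_csInf hne ?_)
    rintro r ⟨hr, hrt⟩
    rw [← Real.le_log_iff_exp_le hr]
    rw [one_div, Real.log_inv] at hrt
    by_cases hlog : 0 ≤ Real.log r
    · have : 0 ≤ c₂ * t := by positivity
      linarith
    · have h3 := h₁ r hr
      have h4 := h₂ (r / α₁ r ^ 2) (by positivity)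
      have h5 : 1 ≤ α₁ r ^ 2 * α₂ (r / α₁ r ^ 2) := by nlinarith
      nlinarith
  have hxi : xi α₁ α₂ c₁ c₂ t = c₁ * sInf S := rfl
  have hxipos : 0 < xi α₁ α₂ c₁ c₂ t := hxi ▸ mul_pos hc₁ hpos
  by_cases hfin : Ψ f = ∞
  · rw [hfin, add_top, ENNReal.mul_top (by simpa using hxipos)]
    exact le_top
  set Y := ‖f‖ ^ 2 + (Ψ f).toReal with hY
  have hY0 : 0 ≤ Y := by positivity
  have hmain : ‖P t f - meanL2 π ν f‖ ^ 2 ≤ xi α₁ α₂ c₁ c₂ t * Y := by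
    rcases hY0.eq_or_lt with h0 | h0
    · have := h t f hf hfin 1 one_pos (by simp; positivity)
      rw [← hY, ← h0] at this
      rw [← h0]
      linarith
    · rw [hxi, mul_right_comm, ← div_le_iff₀' (by positivity)]
      refine le_csInf hne ?_
      rintro r ⟨hr, hrt⟩
      rw [div_le_iff₀' (by positivity), mul_right_comm]
      exact h t f hf hfin r hr hrt
  calc ENNReal.ofReal (‖P t f - meanL2 π ν f‖ ^ 2) ≤ ENNReal.ofReal (xi α₁ α₂ c₁ c₂ t * Y) :=
        ENNReal.ofReal_le_ofReal hmain
    _ = _ := by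
        rw [ENNReal.ofReal_mul hxipos.le, hY, ENNReal.ofReal_add (by positivity) (by positivity),
          ENNReal.ofReal_toReal hfin]

end Assembly

/-! ### Elementary bounds on the constants. -/

section Constants

theorem rpow_half_facts {m : ℝ} (hm : 0 < m) :
    0 < (m / 2) ^ (-(1 / 2) : ℝ) ∧ ((m / 2) ^ (-(1 / 2) : ℝ)) ^ 2 = 2 / m ∧
      2 * (1 / (2 * √m)) ≤ (m / 2) ^ (-(1 / 2) : ℝ) := by
  have h0 : 0 < m / 2 := by positivity
  have h1 : 0 < (m / 2) ^ (-(1 / 2) : ℝ) := Real.rpow_pos_of_pos h0 _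
  have h2 : ((m / 2) ^ (-(1 / 2) : ℝ)) ^ 2 = 2 / m := by
    rw [← Real.rpow_natCast, ← Real.rpow_mul h0.le]
    norm_num
    rw [Real.rpow_neg_one, inv_div]
  refine ⟨h1, h2, ?_⟩
  refine le_of_sq_le_sq ?_ h1.le
  rw [h2, mul_pow, div_pow, mul_pow, Real.sq_sqrt hm.le, one_pow]
  have h3 : (2 : ℝ) ^ 2 * (1 / (2 ^ 2 * m)) = 1 / m := by field_simp
  rw [h3]
  gcongr
  norm_num

/-- Of ε only these bounds matter: with `(m / 2)^(-1/2) ≤ 2` they keep the denominator of `const₁`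
between `1 / 2` and `1`. -/
theorem eps_mem {α₁ α₂ : ℝ → ℝ} {R₀ m : ℝ} (hR₀ : 1 ≤ R₀) (hm : 1 ≤ m)
    (h₁ : ∀ r, 0 < r → 1 ≤ α₁ r) (h₂ : ∀ r, 0 < r → 1 ≤ α₂ r) :
    0 ≤ eps α₁ α₂ R₀ m ∧ eps α₁ α₂ R₀ m ≤ 1 / 4 := by
  have key : ∀ r, 0 < r → 4 ≤ α₂ (r / α₁ r ^ 2) * (R₀ ^ 2 * (α₁ r + m) + 2) := by
    intro r hr
    have h3 := h₁ r hr
    have h4 := h₂ (r / α₁ r ^ 2) (by positivity)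
    have h5 : 1 ≤ R₀ ^ 2 := by nlinarith
    have h6 : 4 ≤ R₀ ^ 2 * (α₁ r + m) + 2 := by nlinarith
    nlinarith
  constructor
  · refine Real.sSup_nonneg ?_
    rintro _ ⟨r, hr, rfl⟩
    have := key r hr
    rw [epsAt]; positivity
  · refine Real.sSup_le ?_ (by norm_num)
    rintro _ ⟨r, hr, rfl⟩
    exact one_div_le_one_div_of_le (by norm_num) (key r hr)

/-- Bound on the quantity which governs the rate. -/
theorem mul_add_two_le {R₀ m A b : ℝ} (hm : 0 < m) (hA : 1 ≤ A) (hb : b = 1 + m * A) :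
    b * (R₀ ^ 2 * b + 2) ≤ (1 + m) * (R₀ ^ 2 * (1 + m) + 2) * A ^ 2 := by
  have h1 : b ≤ (1 + m) * A := by rw [hb]; linarith
  have h0 : 0 ≤ b := by rw [hb]; positivity
  have h2 : b ^ 2 ≤ ((1 + m) * A) ^ 2 := pow_le_pow_left₀ h0 h1 2
  have h3 : b ≤ (1 + m) * A ^ 2 := h1.trans (by nlinarith)
  have h4 := mul_le_mul_of_nonneg_left h2 (sq_nonneg R₀)
  linarith

end Constants

/-! ### The choice of `δ` and of the constants. -/

section Decay

variable {X V : Type*} [MeasurableSpace X] [MeasurableSpace V]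
  {π : Measure X} {ν : Measure V} [IsProbabilityMeasure π] [IsProbabilityMeasure ν]
  {L : L2 π ν →ₗ.[ℝ] L2 π ν} {P : ℝ≥0 → L2 π ν →L[ℝ] L2 π ν} {C : Submodule ℝ (L2 π ν)}
  {Ψ : L2 π ν → ℝ≥0∞} {α₁ α₂ : ℝ → ℝ} {m₂ R₀ : ℝ}

/-- Decay with constants given by the weight `d` of the entropy correction and a bound `τ` on the
size of that correction. -/
theorem OperatorSetting.decayBound
    (hs : OperatorSetting L P C (velocityAverage π ν) (oneL2 π ν) m₂ R₀)
    (hΨ : PsiCondition L P C Ψ) (hwp : WeakPoincareCondition L C Ψ α₁ α₂) {d τ c₁ c₂ : ℝ}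
    (hd : 0 < d) (hd1 : d ≤ 1) (hτ1 : τ < 1) (hc₁ : 0 < c₁) (hc₂ : 0 < c₂)
    (hτ : ∀ b, 1 + m₂ ≤ b → d / (R₀ ^ 2 * b + 2) * (1 / (2 * √m₂)) ≤ τ)
    (h₂ : c₂ * (1 + τ) * ((1 + m₂) * (R₀ ^ 2 * (1 + m₂) + 2)) ≤ d)
    (h₁ : 2 * ((1 + τ) / (1 - τ)) * ((1 + m₂) * (R₀ ^ 2 * (1 + m₂) + 2) / d + 1) ≤ c₁) :
    DecayBound L P Ψ (xi α₁ α₂ c₁ c₂) := by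
  refine decayBound_of_forall hc₁ hc₂ hwp.one_le₁ hwp.one_le₂ fun t f hf hfin r hr hrt => ?_
  have hm := hs.pos
  have hA1 := hwp.one_le₁ r hr
  have ha1 := hwp.one_le₂ (r / α₁ r ^ 2) (by positivity)
  have hk0 : 0 < 1 / (2 * √m₂) := by have := Real.sqrt_pos.2 hm; positivity
  have hN := mul_add_two_le (R₀ := R₀) hm hA1 rfl
  have hb : 1 + m₂ ≤ 1 + m₂ * α₁ r := by nlinarith
  have hτb := hτ _ hb
  obtain ⟨a, ha⟩ : ∃ a, a = α₂ (r / α₁ r ^ 2) := ⟨_, rfl⟩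
  obtain ⟨b, hbdef⟩ : ∃ b, b = 1 + m₂ * α₁ r := ⟨_, rfl⟩
  rw [← ha] at ha1
  rw [← hbdef] at hN hb hτb
  have hb0 : 0 < b := by linarith
  have hw : 0 < R₀ ^ 2 * b + 2 := by positivity
  -- This is the value of `δ`: the largest one that the dissipation estimate admits, times `d ≤ 1`.
  have hδ0 : 0 < d / (a * (R₀ ^ 2 * b + 2)) := by positivity
  have hδτ : d / (a * (R₀ ^ 2 * b + 2)) * (1 / (2 * √m₂)) ≤ τ := by
    refine le_trans (mul_le_mul_of_nonneg_right ?_ hk0.le) hτb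
    exact div_le_div_of_nonneg_left hd.le hw (by nlinarith)
  have hτ0 : 0 < τ := (by positivity : _ < _).trans_le hδτ
  set N := (1 + m₂) * (R₀ ^ 2 * (1 + m₂) + 2) with hNdef
  have hN0 : 0 < N := by positivity
  refine hs.norm_sq_le hΨ hwp hf t hr ENNReal.toReal_nonneg (ENNReal.ofReal_toReal hfin).ge ha hbdef
    hδ0 ?_ (hδτ.trans_lt hτ1) ?_ ?_ hrt
  · rwa [div_mul_cancel₀ _ (by positivity)]
  · have e1 : d / (a * (R₀ ^ 2 * b + 2)) / b * (α₁ r ^ 2 * a)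
        = d * α₁ r ^ 2 / (b * (R₀ ^ 2 * b + 2)) := by
      field_simp
    rw [e1, le_div_iff₀ (by positivity)]
    calc _ ≤ c₂ * (1 + τ) * (N * α₁ r ^ 2) := by gcongr
      _ = c₂ * (1 + τ) * N * α₁ r ^ 2 := by ring
      _ ≤ d * α₁ r ^ 2 := by gcongr
  · refine le_trans ?_ h₁
    have e2 : b / (α₁ r ^ 2 * a * (d / (a * (R₀ ^ 2 * b + 2))))
        = b * (R₀ ^ 2 * b + 2) / α₁ r ^ 2 / d := by
      field_simp
    rw [e2]
    have e3 : b * (R₀ ^ 2 * b + 2) / α₁ r ^ 2 ≤ N := by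
      rw [div_le_iff₀ (by positivity)]; exact hN
    have e4 : 0 < 1 - τ := by linarith
    gcongr

theorem OperatorSetting.exists_decayBound
    (hs : OperatorSetting L P C (velocityAverage π ν) (oneL2 π ν) m₂ R₀)
    (hΨ : PsiCondition L P C Ψ) (hwp : WeakPoincareCondition L C Ψ α₁ α₂) :
    ∃ c₁ c₂ : ℝ, 0 < c₁ ∧ 0 < c₂ ∧ DecayBound L P Ψ (xi α₁ α₂ c₁ c₂) := by
  have hm := hs.pos
  have hsq := Real.sqrt_pos.2 hm
  -- The cap at `√m₂` makes the entropy correction at most half of the main term even for small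
  -- `m₂`, whence `τ = 1 / 2`, `(1 + τ) / (1 - τ) = 3` and the factor `6`.
  set d := min 1 (√m₂) with hd
  have hd0 : 0 < d := lt_min one_pos hsq
  set N := (1 + m₂) * (R₀ ^ 2 * (1 + m₂) + 2) with hN
  have hN0 : 0 < N := by positivity
  refine ⟨6 * (N / d + 1), d / (3 / 2 * N), by positivity, by positivity,
    hs.decayBound hΨ hwp (d := d) (τ := 1 / 2) hd0 (min_le_left _ _) (by norm_num) (by positivity)
      (by positivity) (fun b hb => ?_) (le_of_eq ?_) (le_of_eq ?_)⟩
  · have hw : 1 ≤ R₀ ^ 2 * b + 2 := by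
      have : 0 ≤ R₀ ^ 2 * b := mul_nonneg (sq_nonneg _) (by linarith)
      linarith
    calc d / (R₀ ^ 2 * b + 2) * (1 / (2 * √m₂)) ≤ √m₂ * (1 / (2 * √m₂)) := by
          gcongr
          exact (div_le_self hd0.le hw).trans (min_le_right _ _)
      _ = 1 / 2 := by field_simp
  · rw [← hN]; field_simp; norm_num
  · rw [← hN]; norm_num

theorem OperatorSetting.decayBound_of_one_le
    (hs : OperatorSetting L P C (velocityAverage π ν) (oneL2 π ν) m₂ R₀)
    (hΨ : PsiCondition L P C Ψ) (hwp : WeakPoincareCondition L C Ψ α₁ α₂) (hR₀ : 1 ≤ R₀)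
    (hm₂ : 1 ≤ m₂) :
    0 < const₁ R₀ m₂ (eps α₁ α₂ R₀ m₂) ∧ 0 < const₂ R₀ m₂ ∧
      DecayBound L P Ψ (xi α₁ α₂ (const₁ R₀ m₂ (eps α₁ α₂ R₀ m₂)) (const₂ R₀ m₂)) := by
  have hm := hs.pos
  obtain ⟨hκ0, hκsq, hκ⟩ := rpow_half_facts hm
  obtain ⟨he0, he1⟩ := eps_mem hR₀ hm₂ hwp.one_le₁ hwp.one_le₂
  set ε := eps α₁ α₂ R₀ m₂
  set κ := (m₂ / 2) ^ (-(1 / 2) : ℝ)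
  have hk0 : 0 < 1 / (2 * √m₂) := by have := Real.sqrt_pos.2 hm; positivity
  have hk : 1 / (2 * √m₂) ≤ 1 / 2 := by
    have : 1 ≤ √m₂ := Real.one_le_sqrt.2 hm₂
    exact one_div_le_one_div_of_le (by norm_num) (by linarith)
  have hκ2 : κ ≤ 2 := by
    refine le_of_sq_le_sq ?_ (by norm_num)
    rw [hκsq, div_le_iff₀ hm]; linarith
  have hR2 : 1 ≤ R₀ ^ 2 := by nlinarith
  set q := R₀ ^ 2 * (1 + m₂) ^ 2 with hq
  have hc1 : const₁ R₀ m₂ ε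
      = 2 * max ((1 + ε * κ) / 2) ((2 + κ) * (q + 1)) / (1 - ε * κ) := rfl
  have hc2 : const₂ R₀ m₂ = 1 / (R₀ ^ 2 * (2 + κ) * (1 + m₂) ^ 2) := rfl
  have hq0 : 0 < q := by positivity
  have hεκ : ε * κ ≤ 1 / 2 := by nlinarith
  have hεκ0 : 0 ≤ ε * κ := by positivity
  have hlow : 2 * ((2 + κ) * (q + 1)) ≤ const₁ R₀ m₂ ε := by
    rw [hc1, le_div_iff₀ (by linarith)]
    have h1 := le_max_right ((1 + ε * κ) / 2) ((2 + κ) * (q + 1))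
    have h2 : 0 ≤ 2 * ((2 + κ) * (q + 1)) := by positivity
    nlinarith
  have hc1pos : 0 < const₁ R₀ m₂ ε := lt_of_lt_of_le (by positivity) hlow
  have hc2pos : 0 < const₂ R₀ m₂ := by rw [hc2]; positivity
  -- The excess over `q` is `2 (1 + m₂)`, at most `q` because `R₀ ≥ 1` and `1 + m₂ ≥ 2`.
  have hN : (1 + m₂) * (R₀ ^ 2 * (1 + m₂) + 2) ≤ 2 * q := by nlinarith
  -- No cap is needed now: `b ≥ 2` gives `R₀² b + 2 ≥ 4`, so `d = 1` is allowed with `τ = k / 4`,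
  -- where `k = 1 / (2 √m₂)`.
  refine ⟨hc1pos, hc2pos, hs.decayBound hΨ hwp (d := 1) (τ := 1 / (2 * √m₂) / 4) one_pos le_rfl
    (by linarith) hc1pos hc2pos (fun b hb => ?_) ?_ ?_⟩
  · have hw : 4 ≤ R₀ ^ 2 * b + 2 := by nlinarith
    calc 1 / (R₀ ^ 2 * b + 2) * (1 / (2 * √m₂)) ≤ 1 / 4 * (1 / (2 * √m₂)) := by gcongr
      _ = _ := by ring
  · set k := 1 / (2 * √m₂)
    have e1 : const₂ R₀ m₂ = 1 / ((2 + κ) * q) := by rw [hc2, hq]; ring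
    calc const₂ R₀ m₂ * (1 + k / 4) * ((1 + m₂) * (R₀ ^ 2 * (1 + m₂) + 2))
        ≤ const₂ R₀ m₂ * (1 + k / 4) * (2 * q) := by gcongr
      _ = (2 + k / 2) / (2 + κ) := by rw [e1]; field_simp; ring
      _ ≤ 1 := by rw [div_le_one (by positivity)]; linarith
  · refine le_trans ?_ hlow
    set k := 1 / (2 * √m₂)
    -- The quotient is `1 + (k / 2) / (1 - k / 4)`; `k ≤ 1 / 2` bounds the denominator below by `7 /
    -- 8`, and `2k ≤ κ`.
    have h1 : (1 + k / 4) / (1 - k / 4) ≤ 1 + 2 / 7 * κ := by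
      rw [div_le_iff₀ (by linarith)]
      nlinarith
    have h2 : 2 * ((1 + k / 4) / (1 - k / 4)) ≤ 2 * (1 + 2 / 7 * κ) := by linarith
    rw [div_one]
    calc _ ≤ 2 * (1 + 2 / 7 * κ) * (2 * q + 1) :=
          mul_le_mul h2 (by linarith) (by positivity) (by positivity)
      _ ≤ 2 * ((2 + κ) * (q + 1)) := by nlinarith [mul_pos hκ0 hq0]

end Decay

end Hypocoercivity

end

theorem theorem1 {X V : Type*} [MeasurableSpace X] [MeasurableSpace V]
    (π : Measure X) (ν : Measure V) [IsProbabilityMeasure π] [IsProbabilityMeasure ν]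
    (L : Hypocoercivity.L2 π ν →ₗ.[ℝ] Hypocoercivity.L2 π ν)
    (P : ℝ≥0 → Hypocoercivity.L2 π ν →L[ℝ] Hypocoercivity.L2 π ν)
    (C : Submodule ℝ (Hypocoercivity.L2 π ν))
    (Ψ : Hypocoercivity.L2 π ν → ℝ≥0∞) (α₁ α₂ : ℝ → ℝ) (m₂ R₀ : ℝ)
    (hm₂ : 0 < m₂) (hR₀ : 1 ≤ R₀)
    (hcore : Hypocoercivity.CoreCondition L P C)
    (hstable : ∀ f ∈ C, Hypocoercivity.velocityAverage π ν f ∈ C)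
    (hproj : Hypocoercivity.ProjectionCondition L C)
    (hrem : Hypocoercivity.RemainderCondition m₂ R₀ L C)
    (hΨ : Hypocoercivity.PsiCondition L P C Ψ)
    (hwp : Hypocoercivity.WeakPoincareCondition L C Ψ α₁ α₂) :
    (∃ c₁ c₂ : ℝ, 0 < c₁ ∧ 0 < c₂ ∧
      Hypocoercivity.DecayBound L P Ψ (Hypocoercivity.xi α₁ α₂ c₁ c₂)) ∧
    (1 ≤ m₂ →
      0 < Hypocoercivity.const₁ R₀ m₂ (Hypocoercivity.eps α₁ α₂ R₀ m₂) ∧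
      0 < Hypocoercivity.const₂ R₀ m₂ ∧
      Hypocoercivity.DecayBound L P Ψ (Hypocoercivity.xi α₁ α₂
        (Hypocoercivity.const₁ R₀ m₂ (Hypocoercivity.eps α₁ α₂ R₀ m₂))
        (Hypocoercivity.const₂ R₀ m₂))) := by
  have hs := Hypocoercivity.operatorSetting hm₂ hcore hstable hproj hrem
  exact ⟨hs.exists_decayBound hΨ hwp, hs.decayBound_of_one_le hΨ hwp hR₀⟩
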